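/- Let $m\ge 0$, let $0=\tau^\star_0<\tau^\star_1<\dots<\tau^\star_{m+1}=1$, and put $t^\star_{n,k}=\lfloor n\tau^\star_k\rfloor$, $\boldsymbol t^\star_n=(t^\star_{n,k})_{0\le k\le m+1}$. Let $|\rho^\star|<1$ and let $\boldsymbol\delta^\star=(\delta^\star_0,\dots,\delta^\star_m)\in\mathbb R^{m+1}$ satisfy $\delta^\star_k\ne\delta^\star_{k-1}$ for $1\le k\le m$. Let $(\epsilon_i)_{i\ge1}$ be i.i.d. real random variables with mean zero and finite variance, let $z_0$ be a real random variable (no independence from the $\epsilon_i$ is required), and for every $n$ let $z=(z_0,\dots,z_n)$ be defined by $$z_i=\rho^\star z_{i-1}+\delta^\star_k+\epsilon_i,\qquad t^\star_{n,k}<i\le t^\star_{n,k+1},\quad 0\le k\le m .$$ Let $\overline\rho_n$ be real random variables with $\overline\rho_n-\rho^\star=O_P(n^{-1/2})$ as $n\to\infty$. Let $(\Delta_n)$ be real numbers and $$\mathcal A_{n,m}=\{\boldsymbol t\in\mathbb N^{m+2}:\ 0=t_0<t_1<\dots<t_m<t_{m+1}=n,\ t_{k}-t_{k-1}\ge\Delta_n\text{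 for }1\le k\le m+1\},$$ and assume that $\boldsymbol t^\star_n\in\mathcal A_{n,m}$ for all large $n$. For all large $n$ let $(\widehat{\boldsymbol\delta}_n,\widehat{\boldsymbol t}_n)$ be any minimizer over $\mathbb R^{m+1}\times\mathcal A_{n,m}$ of the least-squares criterion of the decorrelated series $\overline w_i=z_i-\overline\rho_n z_{i-1}$, $$(\boldsymbol\delta,\boldsymbol t)\longmapsto\sum_{k=0}^{m}\ \sum_{i=t_k+1}^{t_{k+1}}\bigl(z_i-\overline\rho_n z_{i-1}-\delta_k\bigr)^2,$$ and let $\widehat{\boldsymbol\tau}_n=n^{-1}\widehat{\boldsymbol t}_n$. Then, as $n\to\infty$: 1. $\|\widehat{\boldsymbol\tau}_n-\boldsymbol\tau^\star\|_\infty\to0$ in probability; 2. $\|\widehat{\boldsymbol\tau}_n-\boldsymbol\tau^\star\|_\infty=O_P(n^{-1})$; 3. $\|\widehat{\boldsymbol\delta}_n-\boldsymbol\delta^\star\|=O_P(n^{-1/2})$, where $\|\cdot\|$ is the Euclidean norm. Here $X_n=O_P(a_n)$ means that for every $\eta>0$ there is $M$ with $P(|X_n|>Ma_n)\le\eta$ for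 all large $n$. -/

import Mathlib

open MeasureTheory ProbabilityTheory Filter Topology

namespace AR1Seg

/-- Boundedness in probability relative to a rate: `X n = O_P (a n)` as `n → ∞`. -/
def IsBigOP {Ω : Type*} [MeasurableSpace Ω] (P : Measure Ω) (X : ℕ → Ω → ℝ) (a : ℕ → ℝ) : Prop :=
  ∀ η : ℝ, 0 < η → ∃ M : ℝ, ∀ᶠ n in atTop, P {ω | M * a n < |X n ω|} ≤ ENNReal.ofReal η

/-- The change-point instants `⌊n τ_k⌋`, `0 ≤ k ≤ m + 1`, attached to the fractions `τ_k`. -/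
noncomputable def changeTimes {m : ℕ} (τ : Fin (m + 2) → ℝ) (n : ℕ) : Fin (m + 2) → ℕ :=
  fun k => ⌊(n : ℝ) * τ k⌋₊

/-- The admissible segmentations: `0 = t_0 < t_1 < ⋯ < t_m < t_{m+1} = n` with all the segment
lengths `t_{k+1} - t_k` at least `Δ`. -/
def admissible (m : ℕ) (Δ : ℝ) (n : ℕ) : Set (Fin (m + 2) → ℕ) :=
  {t | t 0 = 0 ∧ t (Fin.last (m + 1)) = n ∧ StrictMono t ∧
    ∀ k : Fin (m + 1), Δ ≤ (t k.succ : ℝ) - (t k.castSucc : ℝ)}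

/-- The series `z_0, z_1, …` satisfies `z_i = ρ z_{i-1} + δ_k + ε_i` for `t_k < i ≤ t_{k+1}`,
`0 ≤ k ≤ m`. (The level is `δ_k = (1 - ρ) μ_k` when the equation is written
`z_i - μ_k = ρ (z_{i-1} - μ_k) + ε_i`.) -/
def IsSegmentedAR1 {m : ℕ} (ρ : ℝ) (δ : EuclideanSpace ℝ (Fin (m + 1))) (t : Fin (m + 2) → ℕ)
    (ε z : ℕ → ℝ) : Prop :=
  ∀ k : Fin (m + 1), ∀ i ∈ Finset.Ioc (t k.castSucc) (t k.succ),
    z i = ρ * z (i - 1) + δ k + ε i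

/-- The decorrelated series `z - ρ B z`, with `B` the backward shift; only used at `i ≥ 1`. -/
def decorrelate (ρ : ℝ) (z : ℕ → ℝ) (i : ℕ) : ℝ := z i - ρ * z (i - 1)

/-- The residual sum of squares of the series `w_1, …, w_n` for the segmentation `t` and the
levels `δ`. -/
noncomputable def sumSq {m : ℕ} (w : ℕ → ℝ) (δ : EuclideanSpace ℝ (Fin (m + 1)))
    (t : Fin (m + 2) → ℕ) : ℝ :=
  ∑ k : Fin (m + 1), ∑ i ∈ Finset.Ioc (t k.castSucc) (t k.succ), (w i - δ k) ^ 2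

/-- `(δ, t)` minimizes the residual sum of squares of `w` over all levels in `ℝ^{m+1}` and all
segmentations in `A`. -/
def IsLeastSquaresFit {m : ℕ} (A : Set (Fin (m + 2) → ℕ)) (w : ℕ → ℝ)
    (δ : EuclideanSpace ℝ (Fin (m + 1))) (t : Fin (m + 2) → ℕ) : Prop :=
  t ∈ A ∧ ∀ δ' : EuclideanSpace ℝ (Fin (m + 1)), ∀ t' ∈ A, sumSq w δ t ≤ sumSq w δ' t'

/-- The fractions `t_k / n` of a segmentation `t`, for `n ≥ 1`. -/
noncomputable def fractions {m : ℕ} (n : ℕ) (t : Fin (m + 2) → ℕ) : Fin (m + 2) → ℝ :=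
  fun k => (t k : ℝ) / (n : ℝ)

end AR1Seg

/-! The decorrelated series is `δ l + e i + r i` on the true segment `l`, with `e` the innovations
and `r i = (ρ - ρbar) * z (i - 1)`. A contraction estimate bounds the energy of `z` by `O_P(n)`
whatever the dependence of `z 0` on the noise, so `∑ r i ^ 2 = O_P(1)`.

Cut `{1, …, n}` into the overlaps of the fitted segments `k` with the true segments `l`, and let `G`
be the sum of `(d k - δ l) ^ 2 * card`. Comparing the fit with the truth bounds `G` by twice the
correlation with `e + r`. If each noise sum costs at most a quarter of its quadratic term plus a
multiple of its square root, then `√G` is bounded (`sq_mul_card_overlap_le`). This is used twice in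
`fit_error_le`.

Crude pass: with a finite second moment only, truncation gives `|∑ e| ≤ √(2θn) √(q - p)` on all
intervals, for `θ` as small as desired. Hence `G` is a small multiple of `n`, and every fitted
change point lies within about `h n` of its true one (`near_of_sq_mul_card_overlap_le`).

Sharp pass: diagonal overlaps now have length of order `n`, so Kolmogorov's inequality suffices
there. An off-diagonal overlap touches a true change point and its level error is at least half the
smallest jump, so a noise bound of small slope plus a constant (`exists_measure_drift_le`) is
absorbed. Hence `G = O_P(1)`. Off-diagonal overlaps give the rate for the change points, diagonal
ones the rate for the levels, and consistency follows from the rate. -/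

namespace AR1Seg

/-! ### Kolmogorov's maximal inequality -/

section MaximalInequality

variable {Ω : Type*} [mΩ : MeasurableSpace Ω] {P : Measure Ω}

/-- One-step Pythagoras identity for the squared partial sums of independent centred variables,
over an event of the past. -/
lemma setIntegral_sq_sum_range_succ {X : ℕ → Ω → ℝ} (hX : ∀ i, StronglyMeasurable (X i))
    (hL2 : ∀ i, MemLp (X i) 2 P) (hmean : ∀ i, ∫ ω, X i ω ∂P = 0) (hindep : iIndepFun X P)
    (i : ℕ) {s : Set Ω} (hs : MeasurableSet[Filtration.natural X hX i] s) :
    ∫ ω in s, (∑ j ∈ Finset.range (i + 2), X j ω) ^ 2 ∂P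
      = ∫ ω in s, (∑ j ∈ Finset.range (i + 1), X j ω) ^ 2 ∂P + ∫ ω in s, X (i + 1) ω ^ 2 ∂P := by
  set ℱ := Filtration.natural X hX with hℱ
  have hs' : MeasurableSet s := ℱ.le i s hs
  set S : Ω → ℝ := fun ω => ∑ j ∈ Finset.range (i + 1), X j ω with hS
  have hSm : StronglyMeasurable[ℱ i] S := by
    refine Finset.stronglyMeasurable_fun_sum _ fun j hj => ?_
    exact ((Filtration.stronglyAdapted_natural hX) j).mono
      (ℱ.mono (Nat.lt_succ_iff.mp (Finset.mem_range.mp hj)))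
  have hSL2 : MemLp S 2 P := memLp_finsetSum _ fun j _ => hL2 j
  have hind : IndepFun (s.indicator S) (X (i + 1)) P := by
    rw [IndepFun_iff_Indep]
    refine (indep_of_indep_of_le_right (hindep.indep_comap_natural_of_lt hX (Nat.lt_succ_self i))
      ?_).symm
    exact (hSm.indicator hs).measurable.comap_le
  -- Both `s` and `S` depend only on `X 0, …, X i`, hence are independent of the centred `X (i +
  -- 1)`.
  have hcross : ∫ ω in s, S ω * X (i + 1) ω ∂P = 0 := by
    rw [← integral_indicator hs']
    have h1 : s.indicator (fun ω => S ω * X (i + 1) ω)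
        = fun ω => s.indicator S ω * X (i + 1) ω := by
      ext ω; by_cases h : ω ∈ s <;> simp [h]
    rw [h1, hind.integral_fun_mul_eq_mul_integral
      (hSL2.1.indicator hs') (hL2 (i + 1)).1, hmean, mul_zero]
  have hi1 : Integrable (fun ω => S ω ^ 2) (P.restrict s) := hSL2.integrable_sq.restrict
  have hi2 : Integrable (fun ω => S ω * X (i + 1) ω) (P.restrict s) :=
    (hSL2.integrable_mul (hL2 (i + 1))).restrict
  have hi3 : Integrable (fun ω => X (i + 1) ω ^ 2) (P.restrict s) :=
    (hL2 (i + 1)).integrable_sq.restrict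
  have hexp : ∀ ω, (∑ j ∈ Finset.range (i + 2), X j ω) ^ 2
      = S ω ^ 2 + 2 * (S ω * X (i + 1) ω) + X (i + 1) ω ^ 2 := by
    intro ω
    rw [Finset.sum_range_succ]
    simp only [hS]
    ring
  simp_rw [hexp]
  have h2 := integral_add hi1 (hi2.const_mul 2)
  have h3 := integral_add (hi1.add (hi2.const_mul 2)) hi3
  simp only [Pi.add_apply] at h3
  rw [h3, h2, integral_const_mul, hcross]
  ring

/-- **Kolmogorov's maximal inequality.** -/
theorem measure_exists_abs_sum_range_gt_le [IsProbabilityMeasure P] {X : ℕ → Ω → ℝ}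
    (hX : ∀ i, StronglyMeasurable (X i))
    (hL2 : ∀ i, MemLp (X i) 2 P) (hmean : ∀ i, ∫ ω, X i ω ∂P = 0) (hindep : iIndepFun X P)
    {v : ℝ} (hv : ∀ i, ∫ ω, X i ω ^ 2 ∂P = v) (N : ℕ) {x : ℝ} (hx : 0 < x) :
    P {ω | ∃ j ≤ N, x < |∑ i ∈ Finset.range j, X i ω|} ≤ ENNReal.ofReal (N * v / x ^ 2) := by
  set ℱ := Filtration.natural X hX with hℱ
  -- The index is shifted by one: the sum of the first `i + 1` variables is what `ℱ i` measures. The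
  -- empty sum is treated separately below.
  set f : ℕ → Ω → ℝ := fun i ω => (∑ j ∈ Finset.range (i + 1), X j ω) ^ 2 with hf
  have hSL2 : ∀ i, MemLp (fun ω => ∑ j ∈ Finset.range (i + 1), X j ω) 2 P :=
    fun i => memLp_finsetSum _ fun j _ => hL2 j
  have hfint : ∀ i, Integrable (f i) P := fun i => (hSL2 i).integrable_sq
  have hsub : Submartingale f ℱ P := by
    refine submartingale_of_setIntegral_le_succ (fun i => ?_) hfint fun i s hs => ?_
    · refine StronglyMeasurable.pow (Finset.stronglyMeasurable_fun_sum _ fun j hj => ?_) 2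
      exact ((Filtration.stronglyAdapted_natural hX) j).mono
        (ℱ.mono (Nat.lt_succ_iff.mp (Finset.mem_range.mp hj)))
    · rw [setIntegral_sq_sum_range_succ hX hL2 hmean hindep i hs]
      exact le_add_of_nonneg_right (integral_nonneg fun ω => sq_nonneg _)
  have hvar : ∀ i : ℕ, ∫ ω, f i ω ∂P = (i + 1) * v := by
    intro i
    induction i with
    | zero => simp [hf, hv]
    | succ i ih =>
      have h := setIntegral_sq_sum_range_succ hX hL2 hmean hindep i
        (s := Set.univ) MeasurableSet.univ
      simp only [Measure.restrict_univ] at h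
      simp only [hf] at ih ⊢
      rw [h, ih, hv]
      push_cast
      ring
  rcases N with _ | N
  · simp [hx.le.not_gt]
  have hx2 : (0 : ℝ) < x ^ 2 := by positivity
  have hmax := maximal_ineq hsub (fun i ω => sq_nonneg _) (ε := (x ^ 2).toNNReal) N
  set A := {ω | ((x ^ 2).toNNReal : ℝ) ≤
    (Finset.range (N + 1)).sup' Finset.nonempty_range_add_one fun k => f k ω} with hA
  have hsubset : {ω | ∃ j ≤ N + 1, x < |∑ i ∈ Finset.range j, X i ω|} ⊆ A := by
    rintro ω ⟨j, hj, hlt⟩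
    rcases j with _ | j
    · simp at hlt; linarith
    · have h1 : x ^ 2 ≤ f j ω := by
        simp only [hf]
        rw [← sq_abs (∑ i ∈ Finset.range (j + 1), X i ω)]
        gcongr
      rw [hA, Set.mem_ofPred_eq, Real.coe_toNNReal _ hx2.le]
      exact h1.trans (Finset.le_sup' (fun k => f k ω) (Finset.mem_range.mpr (by omega)))
  refine (measure_mono hsubset).trans ?_
  have h2 : ∫ ω in A, f N ω ∂P ≤ (N + 1) * v := by
    rw [← hvar N]
    exact setIntegral_le_integral (hfint N) (ae_of_all _ fun ω => sq_nonneg _)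
  rw [ENNReal.ofReal_div_of_pos hx2, ENNReal.le_div_iff_mul_le
    (Or.inl (by simpa using hx.ne')) (Or.inl ENNReal.ofReal_ne_top), mul_comm]
  refine hmax.trans (ENNReal.ofReal_le_ofReal ?_)
  push_cast
  exact h2

end MaximalInequality

/-! ### Probabilistic bounds for sums of the innovations -/

section Tightness

variable {Ω : Type*} [MeasurableSpace Ω] {P : Measure Ω} {ε : ℕ → Ω → ℝ}

lemma sum_Ioc_add_eq_sum_range (f : ℕ → ℝ) (a j : ℕ) :
    ∑ i ∈ Finset.Ioc a (a + j), f i = ∑ i ∈ Finset.range j, f (i + (a + 1)) := by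
  induction j with
  | zero => simp
  | succ j ih =>
    rw [← add_assoc, Finset.sum_Ioc_succ_top (by omega), ih, Finset.sum_range_succ]
    congr 2
    omega

/-- Kolmogorov's maximal inequality over a window of length `N` of an i.i.d. centred sequence. -/
theorem measure_exists_abs_sum_Ioc_gt_le [IsProbabilityMeasure P]
    (hindep : iIndepFun (fun i : ℕ => ε (i + 1)) P)
    (hident : ∀ i : ℕ, 1 ≤ i → IdentDistrib (ε i) (ε 1) P P)
    (hL2 : MemLp (ε 1) 2 P) (hmean : ∫ ω, ε 1 ω ∂P = 0) (a N : ℕ) {x : ℝ} (hx : 0 < x) :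
    P {ω | ∃ j ≤ N, x < |∑ i ∈ Finset.Ioc a (a + j), ε i ω|}
      ≤ ENNReal.ofReal (N * (∫ ω, ε 1 ω ^ 2 ∂P) / x ^ 2) := by
  have hL2' : ∀ i : ℕ, MemLp (ε (i + (a + 1))) 2 P := fun i =>
    (hident _ (by omega)).memLp_iff.mpr hL2
  -- The innovations are only a.e. strongly measurable, while the natural filtration needs strongly
  -- measurable versions.
  set X : ℕ → Ω → ℝ := fun i => (hL2' i).1.mk (ε (i + (a + 1))) with hX
  have hXe : ∀ i, ε (i + (a + 1)) =ᵐ[P] X i := fun i => (hL2' i).1.ae_eq_mk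
  have hind' : iIndepFun (fun i : ℕ => ε (i + (a + 1))) P := by
    have := hindep.precomp (g := fun i : ℕ => i + a) (add_left_injective a)
    exact this
  have key := measure_exists_abs_sum_range_gt_le (P := P) (X := X)
    (fun i => (hL2' i).1.stronglyMeasurable_mk)
    (fun i => (memLp_congr_ae (hXe i)).mp (hL2' i))
    (fun i => by
      rw [← integral_congr_ae (hXe i), (hident _ (by omega)).integral_eq, hmean])
    (hind'.congr hXe) (v := ∫ ω, ε 1 ω ^ 2 ∂P)
    (fun i => by
      rw [← ((hident (i + (a + 1)) (by omega)).sq).integral_eq]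
      exact integral_congr_ae ((hXe i).symm.fun_comp (· ^ 2))) N hx
  refine (measure_mono_ae ?_).trans key
  filter_upwards [ae_all_iff.mpr hXe] with ω hω
  rintro ⟨j, hj, hlt⟩
  refine ⟨j, hj, ?_⟩
  rw [sum_Ioc_add_eq_sum_range] at hlt
  simpa only [hω] using hlt

lemma sum_Ioc_eq_sub (f : ℕ → ℝ) {a p q : ℕ} (hap : a ≤ p) (hpq : p ≤ q) :
    ∑ i ∈ Finset.Ioc p q, f i = ∑ i ∈ Finset.Ioc a q, f i - ∑ i ∈ Finset.Ioc a p, f i := by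
  rw [← Finset.sum_Ioc_consecutive f hap hpq]
  ring

/-- A maximal inequality over all intervals inside a two-sided window around `a`. -/
theorem measure_exists_abs_sum_window_gt_le {v : ℝ}
    (H : ∀ a N : ℕ, ∀ x : ℝ, 0 < x → P {ω | ∃ j ≤ N, x < |∑ i ∈ Finset.Ioc a (a + j), ε i ω|}
      ≤ ENNReal.ofReal (N * v / x ^ 2)) (a N : ℕ) {x : ℝ} (hx : 0 < x) :
    P {ω | ∃ p q : ℕ, a ≤ p + N ∧ p ≤ q ∧ q ≤ a + N ∧ x < |∑ i ∈ Finset.Ioc p q, ε i ω|}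
      ≤ ENNReal.ofReal (8 * N * v / x ^ 2) := by
  -- A sum over `(p, q]` is a difference of two sums started at `a - N`, one of which must exceed `x
  -- / 2`. Truncated subtraction is harmless: the window then starts at `0`.
  refine (measure_mono ?_).trans ((H (a - N) (2 * N) (x / 2) (by positivity)).trans_eq ?_)
  · rintro ω ⟨p, q, hp, hpq, hq, hlt⟩
    by_contra hcon
    simp only [Set.mem_ofPred_eq, not_exists, not_and, not_lt] at hcon
    rw [sum_Ioc_eq_sub _ (show a - N ≤ p by omega) hpq] at hlt
    have h1 := hcon (q - (a - N)) (by omega)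
    have h2 := hcon (p - (a - N)) (by omega)
    rw [show a - N + (q - (a - N)) = q by omega] at h1
    rw [show a - N + (p - (a - N)) = p by omega] at h2
    have h3 := abs_sub (∑ i ∈ Finset.Ioc (a - N) q, ε i ω) (∑ i ∈ Finset.Ioc (a - N) p, ε i ω)
    linarith
  · congr 1
    push_cast
    field_simp
    ring

/-- The partial sums over intervals containing `a` stay below a line of arbitrarily small slope, up
to an additive constant, with probability close to one uniformly in `a`. -/
theorem exists_measure_drift_le {v : ℝ} (hv : 0 ≤ v)
    (H : ∀ a N : ℕ, ∀ x : ℝ, 0 < x → P {ω | ∃ j ≤ N, x < |∑ i ∈ Finset.Ioc a (a + j), ε i ω|}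
      ≤ ENNReal.ofReal (N * v / x ^ 2)) {c η : ℝ} (hc : 0 < c) (hη : 0 < η) :
    ∃ C : ℝ, 0 ≤ C ∧ ∀ a : ℕ, P {ω | ∃ p q : ℕ, p ≤ a ∧ a ≤ q ∧
      c * ((q : ℝ) - p) + C < |∑ i ∈ Finset.Ioc p q, ε i ω|} ≤ ENNReal.ofReal η := by
  obtain ⟨N₀, hN₀⟩ := exists_nat_gt (64 * v / (c ^ 2 * η))
  have hN₀' : (0 : ℝ) < N₀ := lt_of_le_of_lt (by positivity) hN₀
  have hN₀'' : 0 < N₀ := by exact_mod_cast hN₀'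
  refine ⟨c * N₀, by positivity, fun a => ?_⟩
  -- Dyadic peeling by the length of the interval. At scale `2 ^ k * N₀` the line exceeds `c * 2 ^ k
  -- * N₀ / 2`, so the probabilities decay geometrically and sum to `64 * v / (c ^ 2 * N₀)`, whence
  -- the choice of `N₀`.
  set A : ℕ → Set Ω := fun k => {ω | ∃ p q : ℕ, a ≤ p + 2 ^ k * N₀ ∧ p ≤ q ∧ q ≤ a + 2 ^ k * N₀ ∧
    c * 2 ^ k * N₀ / 2 < |∑ i ∈ Finset.Ioc p q, ε i ω|} with hA
  set D : ℝ := 32 * v / (c ^ 2 * N₀) with hD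
  have hAk : ∀ k, P (A k) ≤ ENNReal.ofReal (D * (1 / 2) ^ k) := by
    intro k
    refine (measure_exists_abs_sum_window_gt_le H a (2 ^ k * N₀) (by positivity)).trans_eq ?_
    congr 1
    rw [hD]
    push_cast
    rw [one_div, inv_pow]
    field_simp
    ring
  have hsub : {ω | ∃ p q : ℕ, p ≤ a ∧ a ≤ q ∧
      c * ((q : ℝ) - p) + c * N₀ < |∑ i ∈ Finset.Ioc p q, ε i ω|} ⊆ ⋃ k, A k := by
    rintro ω ⟨p, q, hp, hq, hlt⟩
    have hex : ∃ k : ℕ, q - p ≤ 2 ^ k * N₀ := by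
      refine ⟨q - p, (Nat.lt_two_pow_self (n := q - p)).le.trans ?_⟩
      exact Nat.le_mul_of_pos_right _ hN₀''
    classical
    have hk := Nat.find_spec hex
    rw [Set.mem_iUnion]
    refine ⟨Nat.find hex, p, q, by omega, by omega, by omega, lt_of_le_of_lt ?_ hlt⟩
    rcases hkk : Nat.find hex with _ | k
    · have : (p : ℝ) ≤ q := by exact_mod_cast hp.trans hq
      have h2 : 0 ≤ c * ((q : ℝ) - p) := mul_nonneg hc.le (by linarith)
      have h3 : 0 < c * N₀ := by positivity
      simp only [pow_zero, mul_one]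
      linarith
    · have hk' := Nat.find_min hex (m := k) (by omega)
      have h1 : 2 ^ k * N₀ + p ≤ q := by omega
      have h2 : (2 : ℝ) ^ k * N₀ + p ≤ q := by exact_mod_cast h1
      have h3 : c * ((2 : ℝ) ^ k * N₀) ≤ c * ((q : ℝ) - p) := by
        gcongr; linarith
      have h4 : 0 < c * N₀ := by positivity
      rw [pow_succ]
      linarith
  refine (measure_mono hsub).trans ((measure_iUnion_le A).trans
    ((ENNReal.tsum_le_tsum hAk).trans ?_))
  have hD0 : 0 ≤ D := by positivity
  rw [← ENNReal.ofReal_tsum_of_nonneg (fun k => by positivity)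
    (summable_geometric_two.mul_left D), tsum_mul_left, tsum_geometric_two]
  refine ENNReal.ofReal_le_ofReal ?_
  rw [div_lt_iff₀ (by positivity)] at hN₀
  rw [hD, div_mul_eq_mul_div, div_le_iff₀ (by positivity)]
  linarith

/-- Markov's inequality for the sums of a nonnegative function of an identically distributed
sequence. -/
theorem measure_sum_comp_gt_le [IsProbabilityMeasure P]
    (hident : ∀ i : ℕ, 1 ≤ i → IdentDistrib (ε i) (ε 1) P P)
    {φ : ℝ → ℝ} (hφ : Measurable φ) (hφ0 : ∀ x, 0 ≤ φ x) (hint : Integrable (fun ω => φ (ε 1 ω)) P)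
    {y : ℝ} (hy : 0 < y) (n : ℕ) :
    P {ω | y * n < ∑ i ∈ Finset.Ioc 0 n, φ (ε i ω)}
      ≤ ENNReal.ofReal ((∫ ω, φ (ε 1 ω) ∂P) / y) := by
  rcases Nat.eq_zero_or_pos n with rfl | hn
  · simp
  have hn' : (0 : ℝ) < n := by exact_mod_cast hn
  have hid : ∀ i ∈ Finset.Ioc 0 n,
      IdentDistrib (fun ω => φ (ε i ω)) (fun ω => φ (ε 1 ω)) P P := fun i hi =>
    (hident i (Finset.mem_Ioc.mp hi).1).comp hφ
  have hint' : ∀ i ∈ Finset.Ioc 0 n, Integrable (fun ω => φ (ε i ω)) P := fun i hi =>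
    (hid i hi).integrable_iff.mpr hint
  have hE : ∫ ω, ∑ i ∈ Finset.Ioc 0 n, φ (ε i ω) ∂P = n * ∫ ω, φ (ε 1 ω) ∂P := by
    rw [integral_finsetSum _ hint', Finset.sum_congr rfl fun i hi => (hid i hi).integral_eq]
    simp
  have hM := mul_meas_ge_le_integral_of_nonneg (μ := P)
    (ae_of_all _ fun ω => Finset.sum_nonneg fun i (_ : i ∈ Finset.Ioc 0 n) => hφ0 (ε i ω))
    (integrable_finsetSum _ hint') (y * n)
  rw [hE] at hM
  have hmono : P {ω | y * n < ∑ i ∈ Finset.Ioc 0 n, φ (ε i ω)}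
      ≤ P {ω | y * n ≤ ∑ i ∈ Finset.Ioc 0 n, φ (ε i ω)} := 
    measure_mono (Set.ofPred_subset_ofPred.mpr fun ω hω => le_of_lt hω)
  refine hmono.trans ?_
  rw [← ofReal_measureReal]
  refine ENNReal.ofReal_le_ofReal ?_
  rw [le_div_iff₀ hy]
  have : (n : ℝ) * (P.real {ω | y * n ≤ ∑ i ∈ Finset.Ioc 0 n, φ (ε i ω)} * y)
      ≤ n * ∫ ω, φ (ε 1 ω) ∂P := by
    refine le_trans (le_of_eq ?_) hM
    ring
  exact le_of_mul_le_mul_left this hn'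

lemma integrable_max_sub_zero [IsProbabilityMeasure P] {f : Ω → ℝ} (hf : Integrable f P) (B : ℝ) :
    Integrable (fun ω => max (f ω - B) 0) P :=
  (hf.sub (integrable_const B)).sup (integrable_zero _ _ _)

/-- Dominated convergence as the truncation level grows. Applied to the squared innovation, it
replaces any moment assumption beyond the second. -/
lemma exists_integral_max_sub_le [IsProbabilityMeasure P] {f : Ω → ℝ} (hf : Integrable f P)
    {θ : ℝ} (hθ : 0 < θ) :
    ∃ B : ℝ, 0 < B ∧ ∫ ω, max (f ω - B) 0 ∂P ≤ θ := by
  have hlim : Tendsto (fun B : ℕ => ∫ ω, max (f ω - B) 0 ∂P) atTop (𝓝 (∫ _, (0 : ℝ) ∂P)) := by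
    refine tendsto_integral_of_dominated_convergence (fun ω => |f ω|)
      (fun B => (integrable_max_sub_zero hf B).1) hf.abs (fun B => ae_of_all _ fun ω => ?_)
      (ae_of_all _ fun ω => ?_)
    · rw [Real.norm_of_nonneg (le_max_right _ _)]
      refine max_le ?_ (abs_nonneg _)
      have := le_abs_self (f ω)
      have : (0 : ℝ) ≤ B := Nat.cast_nonneg B
      linarith
    · refine tendsto_const_nhds.congr' ?_
      obtain ⟨B₀, hB₀⟩ := exists_nat_ge (f ω)
      filter_upwards [eventually_ge_atTop B₀] with B hB
      have : (B₀ : ℝ) ≤ B := by exact_mod_cast hB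
      rw [max_eq_right (by linarith)]
  rw [integral_zero] at hlim
  obtain ⟨B, hB1, hB2⟩ := ((hlim.eventually_le_const hθ).and (eventually_gt_atTop 0)).exists
  exact ⟨B, by exact_mod_cast hB2, hB1⟩

/-- A single real random variable is tight. -/
lemma exists_measure_abs_gt_le [IsProbabilityMeasure P] {f : Ω → ℝ} (hf : Measurable f)
    {η : ℝ} (hη : 0 < η) :
    ∃ M : ℝ, 0 < M ∧ P {ω | M < |f ω|} ≤ ENNReal.ofReal η := by
  have hlim : Tendsto (fun M : ℕ => P {ω | (M : ℝ) < |f ω|}) atTop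
      (𝓝 (P (⋂ M : ℕ, {ω | (M : ℝ) < |f ω|}))) := by
    refine tendsto_measure_iInter_atTop (fun M => ?_) (fun M N hMN ω hω => ?_)
      ⟨0, measure_ne_top _ _⟩
    · exact (measurableSet_lt measurable_const hf.abs).nullMeasurableSet
    · have : (M : ℝ) ≤ N := by exact_mod_cast hMN
      exact lt_of_le_of_lt this hω
  have hempty : (⋂ M : ℕ, {ω | (M : ℝ) < |f ω|}) = ∅ := by
    ext ω
    simp only [Set.mem_iInter, Set.mem_ofPred_eq, Set.mem_empty_iff_false, iff_false, not_forall,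
      not_lt]
    exact exists_nat_ge _
  rw [hempty, measure_empty] at hlim
  obtain ⟨M, hM1, hM2⟩ := ((hlim.eventually_le_const
    (ENNReal.ofReal_pos.mpr hη)).and (eventually_gt_atTop 0)).exists
  exact ⟨M, by exact_mod_cast hM2, hM1⟩

end Tightness

/-! ### Common refinement of two segmentations -/

section Partitions

variable {m : ℕ} {s t : Fin (m + 2) → ℕ}

lemma sum_sum_Ioc_fin {M : Type*} [AddCommMonoid M] {N : ℕ} (t : Fin (N + 1) → ℕ)
    (ht : Monotone t) (f : ℕ → M) :
    ∑ k : Fin N, ∑ i ∈ Finset.Ioc (t k.castSucc) (t k.succ), f i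
      = ∑ i ∈ Finset.Ioc (t 0) (t (Fin.last N)), f i := by
  induction N with
  | zero => simp
  | succ N ih =>
    have h := ih (fun k => t k.castSucc) (fun a b hab => ht (by simpa using hab))
    rw [Fin.sum_univ_castSucc]
    simp only [Fin.castSucc_zero, ← Fin.castSucc_succ] at h ⊢
    rw [h, Fin.succ_last]
    exact Finset.sum_Ioc_consecutive f (ht (Fin.zero_le _)) (ht (Fin.le_last _))

/-- The intersection of the `k`-th segment of `s` with the `l`-th segment of `t`. -/
def overlap (s t : Fin (m + 2) → ℕ) (k l : Fin (m + 1)) : Finset ℕ :=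
  Finset.Ioc (max (s k.castSucc) (t l.castSucc)) (min (s k.succ) (t l.succ))

lemma overlap_eq_inter (s t : Fin (m + 2) → ℕ) (k l : Fin (m + 1)) :
    overlap s t k l = Finset.Ioc (s k.castSucc) (s k.succ) ∩ Finset.Ioc (t l.castSucc) (t l.succ) :=
  Finset.Ioc_inter_Ioc.symm

lemma overlap_comm (s t : Fin (m + 2) → ℕ) (k l : Fin (m + 1)) :
    overlap s t k l = overlap t s l k := by
  rw [overlap_eq_inter, overlap_eq_inter, Finset.inter_comm]

lemma sum_overlap {M : Type*} [AddCommMonoid M] (ht : Monotone t) (hs : Monotone s)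
    (h0 : t 0 = s 0) (h1 : t (Fin.last (m + 1)) = s (Fin.last (m + 1))) (f : ℕ → M)
    (k : Fin (m + 1)) :
    ∑ l, ∑ i ∈ overlap s t k l, f i = ∑ i ∈ Finset.Ioc (s k.castSucc) (s k.succ), f i := by
  have h := sum_sum_Ioc_fin t ht
    (fun i => if i ∈ Finset.Ioc (s k.castSucc) (s k.succ) then f i else 0)
  simp only [← Finset.sum_filter] at h
  have hf : ∀ a b c d : ℕ, (Finset.Ioc a b).filter (fun i => i ∈ Finset.Ioc c d)
      = Finset.Ioc c d ∩ Finset.Ioc a b := fun a b c d => by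
    ext i; simp [and_comm]
  simp only [hf, ← overlap_eq_inter] at h
  rw [h, h0, h1, Finset.inter_eq_left.mpr]
  exact Finset.Ioc_subset_Ioc (hs (Fin.zero_le _)) (hs (Fin.le_last _))

end Partitions

/-! ### The basic inequality and its quadratic consequence -/

section LeastSquares

variable {m n : ℕ} {s t : Fin (m + 2) → ℕ} {e r w : ℕ → ℝ}

/-- The basic inequality of least squares: fitting `(d, s)` at least as well as the truth `(δ, t)`
forces the squared error to be dominated by its correlation with the noise. -/
lemma sum_sq_mul_card_overlap_le (hs : Monotone s) (ht : Monotone t)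
    (h0 : s 0 = t 0) (h1 : s (Fin.last (m + 1)) = t (Fin.last (m + 1)))
    {d δ : EuclideanSpace ℝ (Fin (m + 1))}
    (hw : ∀ l : Fin (m + 1), ∀ i ∈ Finset.Ioc (t l.castSucc) (t l.succ), w i = δ l + (e i + r i))
    (hfit : sumSq w d s ≤ sumSq w δ t) :
    ∑ k, ∑ l, (d k - δ l) ^ 2 * (overlap s t k l).card
      ≤ 2 * ∑ k, ∑ l, (d k - δ l) * ∑ i ∈ overlap s t k l, (e i + r i) := by
  have hA : sumSq w d s = ∑ k, ∑ l, ∑ i ∈ overlap s t k l, (w i - d k) ^ 2 :=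
    Finset.sum_congr rfl fun k _ => (sum_overlap ht hs h0.symm h1.symm _ k).symm
  have hB : sumSq w δ t = ∑ k, ∑ l, ∑ i ∈ overlap s t k l, (w i - δ l) ^ 2 := by
    rw [Finset.sum_comm]
    simp only [overlap_comm s t]
    exact Finset.sum_congr rfl fun k _ => (sum_overlap hs ht h0 h1 _ k).symm
  have hterm : ∀ k l, (∑ i ∈ overlap s t k l, (w i - d k) ^ 2)
      = (∑ i ∈ overlap s t k l, (w i - δ l) ^ 2) + ((d k - δ l) ^ 2 * (overlap s t k l).card
        - 2 * ((d k - δ l) * ∑ i ∈ overlap s t k l, (e i + r i))) := by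
    intro k l
    have : ∀ i ∈ overlap s t k l, (w i - d k) ^ 2 = (w i - δ l) ^ 2 +
        ((d k - δ l) ^ 2 - 2 * (d k - δ l) * (e i + r i)) := by
      intro i hi
      rw [overlap_eq_inter] at hi
      rw [hw l i (Finset.mem_inter.mp hi).2]
      ring
    rw [Finset.sum_congr rfl this, Finset.sum_add_distrib, Finset.sum_sub_distrib,
      ← Finset.mul_sum, Finset.sum_const, nsmul_eq_mul]
    ring
  -- The noise sums are made opaque so that distributing sums does not split `e i + r i`.
  obtain ⟨T, hT⟩ : ∃ T : Fin (m + 1) → Fin (m + 1) → ℝ,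
    ∀ k l, T k l = ∑ i ∈ overlap s t k l, (e i + r i) := ⟨_, fun _ _ => rfl⟩
  rw [hA, hB] at hfit
  simp only [← hT] at hterm ⊢
  simp only [hterm, Finset.sum_add_distrib, Finset.sum_sub_distrib] at hfit
  simp only [← Finset.mul_sum] at hfit
  linarith

/-- Cauchy–Schwarz: a perturbation bounded in mean square costs a multiple of the square root of the
length, just like the noise. -/
lemma abs_sum_le_mul_sqrt_card {S T : Finset ℕ} (hST : S ⊆ T) {R : ℝ} (hR : 0 ≤ R)
    (hr : ∑ i ∈ T, r i ^ 2 ≤ R ^ 2) : |∑ i ∈ S, r i| ≤ R * √(S.card : ℝ) := by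
  have h1 : (∑ i ∈ S, r i) ^ 2 ≤ S.card * ∑ i ∈ S, r i ^ 2 := sq_sum_le_card_mul_sum_sq
  have h2 : ∑ i ∈ S, r i ^ 2 ≤ R ^ 2 :=
    (Finset.sum_le_sum_of_subset_of_nonneg hST fun _ _ _ => sq_nonneg _).trans hr
  refine abs_le_of_sq_le_sq ?_ (by positivity)
  rw [mul_pow, Real.sq_sqrt (Nat.cast_nonneg _)]
  calc (∑ i ∈ S, r i) ^ 2 ≤ S.card * ∑ i ∈ S, r i ^ 2 := h1
    _ ≤ S.card * R ^ 2 := by gcongr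
    _ = R ^ 2 * S.card := mul_comm _ _

/-- From the basic inequality, a bound on each squared error `(d k - δ l) ^ 2` times the number
of points where it occurs. -/
theorem sq_mul_card_overlap_le (hs : Monotone s) (ht : Monotone t)
    (hs0 : s 0 = 0) (ht0 : t 0 = 0) (hs1 : s (Fin.last (m + 1)) = n)
    (ht1 : t (Fin.last (m + 1)) = n)
    {d δ : EuclideanSpace ℝ (Fin (m + 1))}
    (hw : ∀ l : Fin (m + 1), ∀ i ∈ Finset.Ioc (t l.castSucc) (t l.succ), w i = δ l + (e i + r i))
    (hfit : sumSq w d s ≤ sumSq w δ t)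
    {R K : ℝ} (hR : 0 ≤ R) (hK : 0 ≤ K) (hr : ∑ i ∈ Finset.Ioc 0 n, r i ^ 2 ≤ R ^ 2)
    (he : ∀ k l, |d k - δ l| * |∑ i ∈ overlap s t k l, e i| ≤
      (d k - δ l) ^ 2 * (overlap s t k l).card / 4
        + K * (|d k - δ l| * √((overlap s t k l).card : ℝ))) (k l : Fin (m + 1)) :
    (d k - δ l) ^ 2 * (overlap s t k l).card ≤ (4 * (m + 1) ^ 2 * (K + R)) ^ 2 := by
  have hbasic := sum_sq_mul_card_overlap_le hs ht (hs0.trans ht0.symm) (hs1.trans ht1.symm) hw hfit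
  set N : Fin (m + 1) → Fin (m + 1) → ℝ := fun k l => ((overlap s t k l).card : ℝ) with hN
  set G : ℝ := ∑ k, ∑ l, (d k - δ l) ^ 2 * N k l with hG
  have hN0 : ∀ k l, 0 ≤ N k l := fun k l => Nat.cast_nonneg _
  have hterm0 : ∀ k l, 0 ≤ (d k - δ l) ^ 2 * N k l := fun k l => mul_nonneg (sq_nonneg _) (hN0 k l)
  have hG0 : 0 ≤ G := Finset.sum_nonneg fun k _ => Finset.sum_nonneg fun l _ => hterm0 k l
  have hleG : ∀ k l, (d k - δ l) ^ 2 * N k l ≤ G := fun k l =>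
    (Finset.single_le_sum (f := fun l => (d k - δ l) ^ 2 * N k l) (fun l _ => hterm0 k l)
      (Finset.mem_univ l)).trans
    (Finset.single_le_sum (f := fun k => ∑ l, (d k - δ l) ^ 2 * N k l)
      (fun k _ => Finset.sum_nonneg fun l _ => hterm0 k l) (Finset.mem_univ k))
  have hsqrt : ∀ k l, |d k - δ l| * √(N k l) ≤ √G := fun k l => by
    rw [← Real.sqrt_sq_eq_abs, ← Real.sqrt_mul (sq_nonneg _)]
    exact Real.sqrt_le_sqrt (hleG k l)
  have hsubset : ∀ k l, overlap s t k l ⊆ Finset.Ioc 0 n := fun k l => by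
    rw [overlap_eq_inter, ← hs0, ← hs1]
    exact Finset.inter_subset_left.trans
      (Finset.Ioc_subset_Ioc (hs (Fin.zero_le _)) (hs (Fin.le_last _)))
  have hcross : ∀ k l, (d k - δ l) * ∑ i ∈ overlap s t k l, (e i + r i)
      ≤ (d k - δ l) ^ 2 * N k l / 4 + (K + R) * (|d k - δ l| * √(N k l)) := by
    intro k l
    rw [Finset.sum_add_distrib, mul_add]
    have h1 : (d k - δ l) * ∑ i ∈ overlap s t k l, e i
        ≤ |d k - δ l| * |∑ i ∈ overlap s t k l, e i| := (le_abs_self _).trans_eq (abs_mul _ _)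
    have h2 : (d k - δ l) * ∑ i ∈ overlap s t k l, r i
        ≤ |d k - δ l| * |∑ i ∈ overlap s t k l, r i| := (le_abs_self _).trans_eq (abs_mul _ _)
    have h3 : |d k - δ l| * |∑ i ∈ overlap s t k l, r i| ≤ |d k - δ l| * (R * √(N k l)) := by
      gcongr
      exact abs_sum_le_mul_sqrt_card (hsubset k l) hR hr
    have h4 := he k l
    linarith
  have hsum : G ≤ 2 * ∑ k : Fin (m + 1), ∑ l : Fin (m + 1),
      ((d k - δ l) ^ 2 * N k l / 4 + (K + R) * √G) := by
    refine hbasic.trans ?_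
    gcongr with k _ l _
    refine (hcross k l).trans ?_
    gcongr
    exact hsqrt k l
  simp only [Finset.sum_add_distrib, ← Finset.sum_div, Finset.sum_const, Finset.card_univ,
    Fintype.card_fin, nsmul_eq_mul] at hsum
  rw [← hG] at hsum
  push_cast at hsum
  have h5 : √G * √G = G := Real.mul_self_sqrt hG0
  -- At this point `G ≤ G / 2 + 2 * (m + 1) ^ 2 * (K + R) * √G`; absorb `G / 2` and divide by `√G`.
  have h6 : √G ≤ 4 * (m + 1) ^ 2 * (K + R) := by
    by_contra hlt
    push Not at hlt
    have hpos : 0 < √G := lt_of_le_of_lt (by positivity) hlt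
    have := mul_lt_mul_of_pos_right hlt hpos
    nlinarith
  refine (hleG k l).trans ?_
  rw [← Real.sq_sqrt hG0]
  exact pow_le_pow_left₀ (Real.sqrt_nonneg _) h6 2

end LeastSquares

/-! ### From small squared error to nearby change points -/

section Localization

variable {m n H : ℕ} {s t : Fin (m + 2) → ℕ} {d δ : Fin (m + 1) → ℝ}

lemma exists_castSucc_le_lt_succ {N : ℕ} {s : Fin (N + 1) → ℕ} {x : ℕ} (h0 : s 0 ≤ x)
    (h1 : x < s (Fin.last N)) : ∃ k : Fin N, s k.castSucc ≤ x ∧ x < s k.succ := by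
  by_contra! hcon
  have : ∀ i, s i ≤ x := fun i => Fin.induction h0 (fun k hk => hcon k hk) i
  exact absurd (this (Fin.last N)) (not_le.mpr h1)

lemma add_le_of_lt_of_gaps {N G : ℕ} {t : Fin (N + 1) → ℕ} (ht : Monotone t)
    (hgap : ∀ k : Fin N, t k.castSucc + G ≤ t k.succ) {i j : Fin (N + 1)} (hij : i < j) :
    t i + G ≤ t j := by
  obtain ⟨k, rfl⟩ := Fin.exists_castSucc_eq.mpr (ne_of_lt (lt_of_lt_of_le hij (Fin.le_last j)))
  exact (hgap k).trans (ht (Fin.castSucc_lt_iff_succ_le.mp hij))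

/-- If the squared error is small compared with the jumps of `δ`, the change points of `s` are
within `H` of those of `t`. -/
theorem near_of_sq_mul_card_overlap_le (hs : StrictMono s) (ht : Monotone t)
    (hs0 : s 0 = 0) (ht0 : t 0 = 0) (hs1 : s (Fin.last (m + 1)) = n)
    (ht1 : t (Fin.last (m + 1)) = n) (hH : 0 < H)
    (hgap : ∀ k : Fin (m + 1), t k.castSucc + 3 * H ≤ t k.succ) {J A : ℝ} (hJ : 0 ≤ J)
    (hjump : ∀ k : Fin m, J ≤ |δ k.succ - δ k.castSucc|)
    (hA : ∀ k l, (d k - δ l) ^ 2 * (overlap s t k l).card ≤ A) (hAJ : 4 * A < J ^ 2 * H)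
    (i : Fin (m + 2)) : t i < s i + H ∧ s i < t i + H := by
  have hex : ∀ i : Fin (m + 2), ∃ j : Fin (m + 2), t i < s j + H ∧ s j < t i + H := by
    intro i
    induction i using Fin.cases with
    | zero => exact ⟨0, by omega, by omega⟩
    | succ i =>
    induction i using Fin.lastCases with
    | last =>
      have hl : t (Fin.last m).succ = n := ht1
      exact ⟨Fin.last (m + 1), by omega, by omega⟩
    | cast l =>
    -- If no `s j` is near `x`, the segment of `s` containing `x` extends by `H` on both sides. Its
    -- single level must then fit both neighbouring levels of `δ`, which costs at least `J ^ 2 * H /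
    -- 4` on one side.
    by_contra! hcon
    have hl1 := hgap l.castSucc
    have hl2 := hgap l.succ
    rw [← Fin.succ_castSucc] at hl2
    set x := t l.castSucc.succ with hx
    have hxn : t l.succ.succ ≤ n := ht1 ▸ ht (Fin.le_last _)
    obtain ⟨k, hk1, hk2⟩ := exists_castSucc_le_lt_succ (s := s) (x := x) (by omega) (by omega)
    have hc1 := hcon k.castSucc
    have hc2 := hcon k.succ
    have hcard1 : H ≤ (overlap s t k l.castSucc).card := by
      rw [overlap, Nat.card_Ioc, ← hx]
      omega
    have hcard2 : H ≤ (overlap s t k l.succ).card := by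
      rw [overlap, Nat.card_Ioc, ← Fin.succ_castSucc, ← hx]
      omega
    have hcard1' : (H : ℝ) ≤ (overlap s t k l.castSucc).card := by exact_mod_cast hcard1
    have hcard2' : (H : ℝ) ≤ (overlap s t k l.succ).card := by exact_mod_cast hcard2
    have h1 := (mul_le_mul_of_nonneg_left hcard1' (sq_nonneg (d k - δ l.castSucc))).trans (hA _ _)
    have h2 := (mul_le_mul_of_nonneg_left hcard2' (sq_nonneg (d k - δ l.succ))).trans (hA _ _)
    have h3 : J ^ 2 ≤ (δ l.succ - δ l.castSucc) ^ 2 := by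
      rw [← sq_abs (δ l.succ - δ l.castSucc)]
      exact pow_le_pow_left₀ hJ (hjump l) 2
    have h4 : (δ l.succ - δ l.castSucc) ^ 2
        ≤ 2 * (d k - δ l.castSucc) ^ 2 + 2 * (d k - δ l.succ) ^ 2 := by
      nlinarith [sq_nonneg ((d k - δ l.castSucc) + (d k - δ l.succ))]
    have h5 := mul_le_mul_of_nonneg_right (h3.trans h4) (Nat.cast_nonneg (α := ℝ) H)
    linarith
  choose j hj1 hj2 using hex
  -- The gaps of `3 * H` force the matching to be strictly increasing, and a strictly increasing
  -- self-map of `Fin (m + 2)` is the identity.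
  have hmono : StrictMono j := by
    intro a b hab
    have h := add_le_of_lt_of_gaps ht hgap hab
    rw [← hs.lt_iff_lt]
    have h1 := hj1 a
    have h2 := hj2 a
    have h3 := hj1 b
    have h4 := hj2 b
    omega
  have hi := hmono.apply_eq (x := i)
  have h1 := hj1 i
  have h2 := hj2 i
  rw [hi] at h1 h2
  exact ⟨h1, h2⟩

/-- When the change points are within `H`, each segment of `s` shares at least `H` points with the
corresponding segment of `t`. -/
lemma le_card_overlap_self (hgap : ∀ k : Fin (m + 1), t k.castSucc + 3 * H ≤ t k.succ)
    (hnear : ∀ i, t i < s i + H ∧ s i < t i + H) (k : Fin (m + 1)) :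
    H ≤ (overlap s t k k).card := by
  have h1 := hnear k.castSucc
  have h2 := hnear k.succ
  have h3 := hgap k
  rw [overlap, Nat.card_Ioc]
  omega

/-- Distinct overlapping segments are neighbours, and their overlap is an interval with an end at
the change point of `t` that separates them. -/
lemma adjacent_of_overlap_nonempty (ht : Monotone t)
    (hgap : ∀ k : Fin (m + 1), t k.castSucc + 3 * H ≤ t k.succ)
    (hnear : ∀ i, t i < s i + H ∧ s i < t i + H) {k l : Fin (m + 1)} (hkl : k ≠ l)
    (hne : 0 < (overlap s t k l).card) :
    ∃ j : Fin m, ((k = j.castSucc ∧ l = j.succ) ∨ (k = j.succ ∧ l = j.castSucc)) ∧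
      max (s k.castSucc) (t l.castSucc) ≤ t j.castSucc.succ ∧
      t j.castSucc.succ ≤ min (s k.succ) (t l.succ) := by
  rw [overlap, Nat.card_Ioc] at hne
  rcases lt_or_gt_of_ne hkl with h | h
  · obtain ⟨j, rfl⟩ := Fin.exists_castSucc_eq.mpr (ne_of_lt (lt_of_lt_of_le h (Fin.le_last l)))
    have hle : j.succ ≤ l := Fin.castSucc_lt_iff_succ_le.mp h
    have hl : l = j.succ := by
      -- Skipping a segment would require a displacement beyond its length, at least `3 * H`.
      by_contra hcon
      have hlt : j.succ < l := lt_of_le_of_ne hle (Ne.symm hcon)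
      have h1 := add_le_of_lt_of_gaps ht hgap
        (show j.succ.castSucc < l.castSucc from Fin.castSucc_lt_castSucc_iff.mpr hlt)
      have h2 := hnear j.castSucc.succ
      rw [Fin.succ_castSucc] at h2 hne
      omega
    subst hl
    refine ⟨j, Or.inl ⟨rfl, rfl⟩, ?_⟩
    have h1 := hnear j.castSucc.castSucc
    have h2 := hgap j.castSucc
    have h3 := hgap j.succ
    rw [← Fin.succ_castSucc] at h3 hne ⊢
    omega
  · obtain ⟨j, rfl⟩ := Fin.exists_castSucc_eq.mpr (ne_of_lt (lt_of_lt_of_le h (Fin.le_last k)))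
    have hle : j.succ ≤ k := Fin.castSucc_lt_iff_succ_le.mp h
    have hk : k = j.succ := by
      by_contra hcon
      have hlt : j.succ < k := lt_of_le_of_ne hle (Ne.symm hcon)
      have h1 := add_le_of_lt_of_gaps ht hgap
        (show j.succ.castSucc < k.castSucc from Fin.castSucc_lt_castSucc_iff.mpr hlt)
      have h2 := hnear k.castSucc
      rw [Fin.succ_castSucc] at hne
      omega
    subst hk
    refine ⟨j, Or.inr ⟨rfl, rfl⟩, ?_⟩
    have h1 := hnear j.succ.succ
    have h2 := hgap j.castSucc
    have h3 := hgap j.succ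
    rw [← Fin.succ_castSucc] at h3 hne ⊢
    omega

/-- When the change points are within `H`, each displacement is the size of an overlap of
neighbouring segments. -/
lemma abs_sub_eq_card_overlap (hgap : ∀ k : Fin (m + 1), t k.castSucc + 3 * H ≤ t k.succ)
    (hnear : ∀ i, t i < s i + H ∧ s i < t i + H) (j : Fin m) :
    |(s j.castSucc.succ : ℝ) - t j.castSucc.succ| = (overlap s t j.castSucc j.succ).card ∨
    |(s j.castSucc.succ : ℝ) - t j.castSucc.succ| = (overlap s t j.succ j.castSucc).card := by
  have h1 := hnear j.castSucc.castSucc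
  have h2 := hnear j.castSucc.succ
  have h3 := hnear j.succ.succ
  have h4 := hgap j.castSucc
  have h5 := hgap j.succ
  rw [← Fin.succ_castSucc] at h5
  simp only [overlap, Nat.card_Ioc, ← Fin.succ_castSucc]
  rcases le_total (t j.castSucc.succ) (s j.castSucc.succ) with h | h
  · left
    rw [← Nat.cast_sub h, abs_of_nonneg (Nat.cast_nonneg _)]
    congr 1
    omega
  · right
    rw [abs_sub_comm, ← Nat.cast_sub h, abs_of_nonneg (Nat.cast_nonneg _)]
    congr 1
    omega

end Localization

/-! ### Deterministic two-pass argument -/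

/-- The deterministic core: bounds on the displacement of the change points and on the error of
the levels, for a noise `e` with controlled partial sums and a perturbation `r` bounded in
mean square. -/
theorem fit_error_le {m n H : ℕ} {s t : Fin (m + 2) → ℕ} {e r w : ℕ → ℝ}
    {d δ : EuclideanSpace ℝ (Fin (m + 1))} (hs : StrictMono s) (ht : Monotone t)
    (hs0 : s 0 = 0) (ht0 : t 0 = 0) (hs1 : s (Fin.last (m + 1)) = n)
    (ht1 : t (Fin.last (m + 1)) = n) (hH : 0 < H)
    (hgap : ∀ k : Fin (m + 1), t k.castSucc + 3 * H ≤ t k.succ) {J R V K C : ℝ} (hJ : 0 < J)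
    (hjump : ∀ k : Fin m, J ≤ |δ k.succ - δ k.castSucc|)
    (hw : ∀ l : Fin (m + 1), ∀ i ∈ Finset.Ioc (t l.castSucc) (t l.succ), w i = δ l + (e i + r i))
    (hfit : sumSq w d s ≤ sumSq w δ t) (hR : 0 ≤ R) (hV : 0 ≤ V) (hK : 0 ≤ K) (hC : 0 ≤ C)
    (hr : ∑ i ∈ Finset.Ioc 0 n, r i ^ 2 ≤ R ^ 2)
    (heV : ∀ p q : ℕ, p ≤ q → q ≤ n → |∑ i ∈ Finset.Ioc p q, e i| ≤ V * √((q : ℝ) - p))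
    (hVR : 4 * (4 * (m + 1) ^ 2 * (V + R)) ^ 2 < J ^ 2 * H)
    (heK : ∀ p q : ℕ, p ≤ q → q ≤ n → |∑ i ∈ Finset.Ioc p q, e i| ≤ K * √(H : ℝ))
    (heC : ∀ j : Fin (m + 2), ∀ p q : ℕ, p ≤ t j → t j ≤ q → q ≤ n →
      |∑ i ∈ Finset.Ioc p q, e i| ≤ J / 8 * ((q : ℝ) - p) + C) :
    (∀ j, |(s j : ℝ) - t j| ≤ 4 * (4 * (m + 1) ^ 2 * (K + C + R)) ^ 2 / J ^ 2) ∧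
    ∀ k, (d k - δ k) ^ 2 * H ≤ (4 * (m + 1) ^ 2 * (K + C + R)) ^ 2 := by
  have hleft : ∀ k l : Fin (m + 1), min (s k.succ) (t l.succ) ≤ n := fun k l =>
    (min_le_right _ _).trans (ht1 ▸ ht (Fin.le_last _))
  have hcard : ∀ k l : Fin (m + 1), max (s k.castSucc) (t l.castSucc) ≤ min (s k.succ) (t l.succ) →
      ((overlap s t k l).card : ℝ)
        = ((min (s k.succ) (t l.succ) : ℕ) : ℝ) - (max (s k.castSucc) (t l.castSucc) : ℕ) := by
    intro k l h
    rw [overlap, Nat.card_Ioc, Nat.cast_sub h]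
  have hempty : ∀ k l : Fin (m + 1), (overlap s t k l).card = 0 → ∑ i ∈ overlap s t k l, e i = 0 :=
    fun k l h => by rw [Finset.card_eq_zero.mp h, Finset.sum_empty]
  have hlt : ∀ k l : Fin (m + 1), 0 < (overlap s t k l).card →
      max (s k.castSucc) (t l.castSucc) ≤ min (s k.succ) (t l.succ) := by
    intro k l h
    rw [overlap, Nat.card_Ioc] at h
    omega
  -- Crude pass, with `V` in the role of `K`; it serves only to localize.
  have hA := sq_mul_card_overlap_le hs.monotone ht hs0 ht0 hs1 ht1 hw hfit hR hV hr
    (fun k l => by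
      rcases Nat.eq_zero_or_pos (overlap s t k l).card with h0 | hpos
      · rw [hempty k l h0, h0]
        simp
      · have h1 := heV _ _ (hlt k l hpos) (hleft k l)
        rw [← hcard k l (hlt k l hpos)] at h1
        have h2 := mul_le_mul_of_nonneg_left h1 (abs_nonneg (d k - δ l))
        have h3 : 0 ≤ (d k - δ l) ^ 2 * (overlap s t k l).card / 4 := by positivity
        rw [overlap] at h2 h3 ⊢
        linarith)
  have hnear := near_of_sq_mul_card_overlap_le hs ht hs0 ht0 hs1 ht1 hH hgap hJ.le hjump hA hVR
  have hHle : ∀ k, (H : ℝ) ≤ (overlap s t k k).card := fun k => by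
    exact_mod_cast le_card_overlap_self hgap hnear k
  have hH' : (0 : ℝ) < H := by exact_mod_cast hH
  have hlevel : ∀ k, |d k - δ k| ≤ J / 2 := by
    intro k
    have h1 := (mul_le_mul_of_nonneg_left (hHle k) (sq_nonneg (d k - δ k))).trans (hA k k)
    refine abs_le_of_sq_le_sq ?_ (by positivity)
    by_contra hcon
    push Not at hcon
    have h2 := mul_lt_mul_of_pos_right hcon hH'
    linarith
  have hdiff : ∀ k l, k ≠ l → 0 < (overlap s t k l).card → J / 2 ≤ |d k - δ l| := by
    intro k l hkl hne
    have h1 := hlevel k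
    have h2 : J ≤ |δ k - δ l| := by
      obtain ⟨j, ⟨rfl, rfl⟩ | ⟨rfl, rfl⟩, -⟩ := adjacent_of_overlap_nonempty ht hgap hnear hkl hne
      · rw [abs_sub_comm]; exact hjump j
      · exact hjump j
    have h3 := abs_sub_le (δ k) (d k) (δ l)
    rw [abs_sub_comm (δ k) (d k)] at h3
    linarith
  -- Sharp pass. On the diagonal the overlap has at least `H` points, so `heK` applies. Off it, `J /
  -- 8 ≤ |d k - δ l| / 4` lets the quadratic term absorb the slope in `heC`, and `C` is paid once
  -- since the overlap has at least one point.
  have hQ := sq_mul_card_overlap_le hs.monotone ht hs0 ht0 hs1 ht1 hw hfit hR (add_nonneg hK hC) hr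
    (fun k l => by
      rcases Nat.eq_zero_or_pos (overlap s t k l).card with h0 | hpos
      · rw [hempty k l h0, h0]
        simp
      have hcpos : (1 : ℝ) ≤ (overlap s t k l).card := by exact_mod_cast hpos
      have habs := abs_nonneg (d k - δ l)
      rcases eq_or_ne k l with rfl | hkl
      · have h1 := heK _ _ (hlt k k hpos) (hleft k k)
        have h2 : √(H : ℝ) ≤ √((overlap s t k k).card : ℝ) := Real.sqrt_le_sqrt (hHle k)
        have h3 := mul_le_mul_of_nonneg_left (h1.trans (mul_le_mul_of_nonneg_left h2 hK)) habs
        have h4 : 0 ≤ (d k - δ k) ^ 2 * (overlap s t k k).card / 4 := by positivity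
        have h5 : 0 ≤ C * (|d k - δ k| * √((overlap s t k k).card : ℝ)) := by positivity
        rw [overlap] at h3 h4 h5 ⊢
        linarith
      · obtain ⟨j, -, hj1, hj2⟩ := adjacent_of_overlap_nonempty ht hgap hnear hkl hpos
        have h1 := heC _ _ _ hj1 hj2 (hleft k l)
        rw [← hcard k l (hlt k l hpos)] at h1
        have h2 : (1 : ℝ) ≤ √((overlap s t k l).card : ℝ) := Real.one_le_sqrt.mpr hcpos
        have h3 := hdiff k l hkl hpos
        have h4 : |d k - δ l| * (J / 8 * (overlap s t k l).card)
            ≤ (d k - δ l) ^ 2 * (overlap s t k l).card / 4 := by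
          rw [← sq_abs (d k - δ l)]
          have := mul_le_mul_of_nonneg_left h3
            (mul_nonneg habs (Nat.cast_nonneg (α := ℝ) (overlap s t k l).card))
          linarith
        have h5 : |d k - δ l| * C ≤ C * (|d k - δ l| * √((overlap s t k l).card : ℝ)) := by
          have := mul_le_mul_of_nonneg_left h2 (mul_nonneg habs hC)
          linarith
        have h6 : 0 ≤ K * (|d k - δ l| * √((overlap s t k l).card : ℝ)) := by positivity
        have h7 := mul_le_mul_of_nonneg_left h1 habs
        rw [overlap] at h4 h5 h6 h7 ⊢
        linarith)
  refine ⟨fun j => ?_, fun k => ?_⟩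
  · have hshort : ∀ k l, k ≠ l → ((overlap s t k l).card : ℝ)
        ≤ 4 * (4 * (m + 1) ^ 2 * (K + C + R)) ^ 2 / J ^ 2 := by
      intro k l hkl
      rcases Nat.eq_zero_or_pos (overlap s t k l).card with h0 | hpos
      · rw [h0, Nat.cast_zero]
        positivity
      · rw [le_div_iff₀ (by positivity)]
        have h1 : (J / 2) ^ 2 ≤ (d k - δ l) ^ 2 := by
          rw [← sq_abs (d k - δ l)]
          exact pow_le_pow_left₀ (by positivity) (hdiff k l hkl hpos) 2
        have h2 := mul_le_mul_of_nonneg_right h1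
          (Nat.cast_nonneg (α := ℝ) (overlap s t k l).card)
        have h3 := hQ k l
        linarith
    have hpos : 0 ≤ 4 * (4 * ((m : ℝ) + 1) ^ 2 * (K + C + R)) ^ 2 / J ^ 2 := by positivity
    induction j using Fin.cases with
    | zero => simpa [hs0, ht0] using hpos
    | succ j =>
    induction j using Fin.lastCases with
    | last => simpa [hs1, ht1, Fin.succ_last] using hpos
    | cast j =>
    have hne : j.castSucc ≠ j.succ := (Fin.castSucc_lt_succ (i := j)).ne
    rcases abs_sub_eq_card_overlap hgap hnear j with h | h
    · rw [h]; exact hshort _ _ hne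
    · rw [h]; exact hshort _ _ hne.symm
  · exact (mul_le_mul_of_nonneg_left (hHle k) (sq_nonneg (d k - δ k))).trans (hQ k k)

/-- Supplies the smallest jump and the shortest gap; the index type of the jumps is empty when `m =
0`. -/
lemma exists_pos_forall_le {ι : Type*} [Finite ι] {f : ι → ℝ} (hf : ∀ i, 0 < f i) :
    ∃ c : ℝ, 0 < c ∧ ∀ i, c ≤ f i := by
  cases isEmpty_or_nonempty ι
  · exact ⟨1, one_pos, fun i => isEmptyElim i⟩
  · obtain ⟨i, hi⟩ := Finite.exists_min f
    exact ⟨f i, hf i, hi⟩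

/-! ### Energy of the autoregressive series -/

section Autoregression

/-- Summing the contraction telescopes; the term `z n ^ 2` is kept because the next step of the
induction consumes it. -/
lemma one_sub_mul_sum_sq_add_le {a : ℝ} {z b : ℕ → ℝ} (n : ℕ)
    (h : ∀ i ∈ Finset.Ioc 0 n, z i ^ 2 ≤ a * z (i - 1) ^ 2 + b i) :
    (1 - a) * ∑ i ∈ Finset.Ioc 0 n, z (i - 1) ^ 2 + z n ^ 2
      ≤ z 0 ^ 2 + ∑ i ∈ Finset.Ioc 0 n, b i := by
  induction n with
  | zero => simp
  | succ n ih =>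
    have h1 := ih fun i hi => h i (Finset.Ioc_subset_Ioc_right (Nat.le_succ n) hi)
    have h2 := h (n + 1) (by simp)
    rw [Finset.sum_Ioc_succ_top (Nat.zero_le n), Finset.sum_Ioc_succ_top (Nat.zero_le n)]
    simp only [Nat.add_sub_cancel] at h2 ⊢
    linarith

/-- The energy of a segmented AR(1) series is controlled by its initial value, its levels and the
energy of its innovations. -/
theorem sum_sq_le_of_isSegmentedAR1 {m n : ℕ} {ρ : ℝ} (hρ : |ρ| < 1)
    {δ : EuclideanSpace ℝ (Fin (m + 1))} {t : Fin (m + 2) → ℕ} {ε z : ℕ → ℝ}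
    (ht0 : t 0 = 0) (ht1 : t (Fin.last (m + 1)) = n) (hz : IsSegmentedAR1 ρ δ t ε z) :
    ∑ i ∈ Finset.Ioc 0 n, z (i - 1) ^ 2
      ≤ (z 0 ^ 2 + (2 * ‖δ‖ ^ 2 * n + 2 * ∑ i ∈ Finset.Ioc 0 n, ε i ^ 2) / (1 - |ρ|))
        / (1 - |ρ|) := by
  have ha : 0 < 1 - |ρ| := by linarith
  have hstep : ∀ i ∈ Finset.Ioc 0 n,
      z i ^ 2 ≤ |ρ| * z (i - 1) ^ 2 + (2 * ‖δ‖ ^ 2 + 2 * ε i ^ 2) / (1 - |ρ|) := by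
    intro i hi
    rw [Finset.mem_Ioc] at hi
    obtain ⟨k, hk1, hk2⟩ := exists_castSucc_le_lt_succ (s := t) (x := i - 1) (by omega) (by omega)
    rw [hz k i (Finset.mem_Ioc.mpr ⟨by omega, by omega⟩)]
    have hδ : |δ k| ≤ ‖δ‖ := PiLp.norm_apply_le δ k
    have hδ2 : δ k ^ 2 ≤ ‖δ‖ ^ 2 := by
      rw [← sq_abs]; exact pow_le_pow_left₀ (abs_nonneg _) hδ 2
    set x := z (i - 1)
    set y := δ k + ε i with hy
    have hy2 : y ^ 2 ≤ 2 * ‖δ‖ ^ 2 + 2 * ε i ^ 2 := by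
      nlinarith [sq_nonneg (δ k - ε i)]
    -- Convexity of the square with weights `|ρ|` and `1 - |ρ|`, the second point being `|y| / (1 -
    -- |ρ|)`.
    have hconv : (ρ * x + y) ^ 2 ≤ |ρ| * x ^ 2 + y ^ 2 / (1 - |ρ|) := by
      have h1 : (ρ * x + y) ^ 2 ≤ (|ρ| * |x| + |y|) ^ 2 := by
        rw [← sq_abs (ρ * x + y), ← abs_mul]
        exact pow_le_pow_left₀ (abs_nonneg _) (abs_add_le _ _) 2
      have h2 : |ρ| * x ^ 2 + y ^ 2 / (1 - |ρ|) - (|ρ| * |x| + |y|) ^ 2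
          = |ρ| / (1 - |ρ|) * ((1 - |ρ|) * |x| - |y|) ^ 2 := by
        rw [← sq_abs x, ← sq_abs y]
        field_simp
        ring
      have h3 : 0 ≤ |ρ| / (1 - |ρ|) * ((1 - |ρ|) * |x| - |y|) ^ 2 := by positivity
      linarith
    rw [add_assoc]
    refine hconv.trans ?_
    gcongr
  have h := one_sub_mul_sum_sq_add_le n hstep
  rw [← Finset.sum_div, Finset.sum_add_distrib, Finset.sum_const, Nat.card_Ioc,
    nsmul_eq_mul, Nat.sub_zero, ← Finset.mul_sum] at h
  rw [le_div_iff₀ ha]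
  have h2 := sq_nonneg (z n)
  rw [mul_comm (n : ℝ)] at h
  linarith

/-- The perturbation caused by plugging in `ρbar` for `ρ` is bounded in mean square. -/
theorem sum_sq_perturbation_le {m n : ℕ} (hn : 0 < n) {ρ ρbar : ℝ} (hρ : |ρ| < 1)
    {δ : EuclideanSpace ℝ (Fin (m + 1))} {t : Fin (m + 2) → ℕ} {ε z : ℕ → ℝ}
    (ht0 : t 0 = 0) (ht1 : t (Fin.last (m + 1)) = n) (hz : IsSegmentedAR1 ρ δ t ε z)
    {L M Z : ℝ} (hε : ∑ i ∈ Finset.Ioc 0 n, ε i ^ 2 ≤ M * n) (hz0 : |z 0| ≤ Z)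
    (hρbar : |ρbar - ρ| ≤ L * (n : ℝ) ^ (-(1 / 2) : ℝ)) :
    ∑ i ∈ Finset.Ioc 0 n, ((ρ - ρbar) * z (i - 1)) ^ 2
      ≤ L ^ 2 * ((Z ^ 2 + (2 * ‖δ‖ ^ 2 + 2 * M) / (1 - |ρ|)) / (1 - |ρ|)) := by
  have ha : 0 < 1 - |ρ| := by linarith
  have hn1 : (1 : ℝ) ≤ n := by exact_mod_cast hn
  have hn0 : (0 : ℝ) < n := by linarith
  have hS : ∑ i ∈ Finset.Ioc 0 n, z (i - 1) ^ 2
      ≤ (Z ^ 2 + (2 * ‖δ‖ ^ 2 + 2 * M) / (1 - |ρ|)) / (1 - |ρ|) * n := by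
    refine (sum_sq_le_of_isSegmentedAR1 hρ ht0 ht1 hz).trans ?_
    rw [div_mul_eq_mul_div, add_mul, div_mul_eq_mul_div]
    have h1 : z 0 ^ 2 ≤ Z ^ 2 * n := by
      rw [← sq_abs]
      have := pow_le_pow_left₀ (abs_nonneg _) hz0 2
      nlinarith [sq_nonneg Z]
    have h2 : 2 * ‖δ‖ ^ 2 * n + 2 * ∑ i ∈ Finset.Ioc 0 n, ε i ^ 2
        ≤ (2 * ‖δ‖ ^ 2 + 2 * M) * n := by linarith
    gcongr
  have hsq : (ρ - ρbar) ^ 2 ≤ L ^ 2 * (n : ℝ)⁻¹ := by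
    have h1 := pow_le_pow_left₀ (abs_nonneg _) hρbar 2
    rw [sq_abs, mul_pow, ← Real.rpow_natCast ((n : ℝ) ^ (-(1 / 2) : ℝ)), ← Real.rpow_mul hn0.le]
      at h1
    norm_num at h1
    rw [Real.rpow_neg_one] at h1
    calc (ρ - ρbar) ^ 2 = (ρbar - ρ) ^ 2 := by ring
      _ ≤ _ := h1
  simp only [mul_pow, ← Finset.mul_sum]
  calc (ρ - ρbar) ^ 2 * ∑ i ∈ Finset.Ioc 0 n, z (i - 1) ^ 2
      ≤ L ^ 2 * (n : ℝ)⁻¹ * ∑ i ∈ Finset.Ioc 0 n, z (i - 1) ^ 2 := by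
        gcongr
    _ ≤ L ^ 2 * (n : ℝ)⁻¹ *
        ((Z ^ 2 + (2 * ‖δ‖ ^ 2 + 2 * M) / (1 - |ρ|)) / (1 - |ρ|) * n) := by gcongr
    _ = _ := by field_simp

end Autoregression

/-! ### Error bounds on the good event -/

/-- Truncation bound: short intervals are controlled by the truncated energy, long ones by the
maximum of the partial sums. -/
theorem abs_sum_Ioc_le_sqrt {e : ℕ → ℝ} {n p q : ℕ} {B K θ : ℝ} (hB : 0 < B) (hθ : 0 < θ)
    (hpq : p ≤ q) (hqn : q ≤ n) (htr : ∑ i ∈ Finset.Ioc 0 n, max (e i ^ 2 - B) 0 ≤ θ * n)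
    (hmax : |∑ i ∈ Finset.Ioc p q, e i| ≤ K * √(n : ℝ)) (hlarge : K ^ 2 * B ≤ 2 * θ ^ 2 * n) :
    |∑ i ∈ Finset.Ioc p q, e i| ≤ √(2 * θ * n) * √((q : ℝ) - p) := by
  have hpq' : (0 : ℝ) ≤ (q : ℝ) - p := sub_nonneg.mpr (by exact_mod_cast hpq)
  have hn0 : (0 : ℝ) ≤ n := Nat.cast_nonneg n
  rw [← Real.sqrt_mul (by positivity)]
  refine Real.abs_le_sqrt ?_
  -- On a short interval the energy is at most `B * (q - p) + θ * n ≤ 2 * θ * n`. On a long one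
  -- `hlarge` gives `K ^ 2 ≤ 2 * θ * (q - p)`.
  rcases le_or_gt (B * ((q : ℝ) - p)) (θ * n) with h | h
  · have h1 : (∑ i ∈ Finset.Ioc p q, e i) ^ 2
        ≤ (Finset.Ioc p q).card * ∑ i ∈ Finset.Ioc p q, e i ^ 2 := sq_sum_le_card_mul_sum_sq
    have h2 : ∑ i ∈ Finset.Ioc p q, e i ^ 2
        ≤ ∑ i ∈ Finset.Ioc p q, (B + max (e i ^ 2 - B) 0) :=
      Finset.sum_le_sum fun i _ => by linarith [le_max_left (e i ^ 2 - B) 0]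
    have h3 : ∑ i ∈ Finset.Ioc p q, max (e i ^ 2 - B) 0 ≤ θ * n :=
      (Finset.sum_le_sum_of_subset_of_nonneg (Finset.Ioc_subset_Ioc (Nat.zero_le p) hqn)
        fun _ _ _ => le_max_right _ _).trans htr
    rw [Finset.sum_add_distrib, Finset.sum_const, nsmul_eq_mul] at h2
    rw [Nat.card_Ioc, Nat.cast_sub hpq] at h1 h2
    refine h1.trans ?_
    rw [mul_comm (2 * θ * n)]
    gcongr
    linarith
  · have h1 : (∑ i ∈ Finset.Ioc p q, e i) ^ 2 ≤ K ^ 2 * n := by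
      rw [← sq_abs, ← Real.sq_sqrt hn0, ← mul_pow]
      exact pow_le_pow_left₀ (abs_nonneg _) hmax 2
    have h2 : K ^ 2 * B ≤ 2 * θ * ((q : ℝ) - p) * B := by nlinarith
    have h3 := le_of_mul_le_mul_right h2 hB
    have h4 := mul_le_mul_of_nonneg_right h3 hn0
    linarith

lemma abs_changeTimes_sub_le {m n : ℕ} (hn : 0 < n) {τ : Fin (m + 2) → ℝ}
    {k : Fin (m + 2)} (hτ : 0 ≤ τ k) : |(changeTimes τ n k : ℝ) - n * τ k| ≤ 1 := by
  have h0 : 0 ≤ (n : ℝ) * τ k := by positivity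
  have h1 := Nat.floor_le h0
  have h2 := Nat.lt_floor_add_one ((n : ℝ) * τ k)
  rw [changeTimes, abs_le]
  constructor <;> linarith

/-- Bounds on the estimation errors on the event where the partial sums, the energies, the initial
value and the plugged-in parameter are all controlled. -/
theorem fit_error_le_of_controlled {m n : ℕ} {ρ ρbar : ℝ} (hρ : |ρ| < 1)
    {τ : Fin (m + 2) → ℝ} (hτ0 : ∀ k, 0 ≤ τ k)
    {δ d : EuclideanSpace ℝ (Fin (m + 1))} {h J : ℝ} (hh : 0 < h) (hJ : 0 < J)
    (hgap : ∀ k : Fin (m + 1), 4 * h ≤ τ k.succ - τ k.castSucc)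
    (hjump : ∀ k : Fin m, J ≤ |δ k.succ - δ k.castSucc|)
    {e z : ℕ → ℝ} (hz : IsSegmentedAR1 ρ δ (changeTimes τ n) e z)
    {D : ℝ} (hadm : changeTimes τ n ∈ admissible m D n) {s : Fin (m + 2) → ℕ}
    (hfit : IsLeastSquaresFit (admissible m D n) (decorrelate ρbar z) d s)
    {K C B θ M Z L E : ℝ} (hK : 0 ≤ K) (hC : 0 ≤ C) (hB : 0 < B) (hθ : 0 < θ) (hM : 0 ≤ M)
    (hE : E = L ^ 2 * ((Z ^ 2 + (2 * ‖δ‖ ^ 2 + 2 * M) / (1 - |ρ|)) / (1 - |ρ|)))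
    (hn1 : 2 ≤ h * n) (hn2 : K ^ 2 * B ≤ 2 * θ ^ 2 * n)
    (hn3 : 512 * ((m : ℝ) + 1) ^ 4 * E < J ^ 2 * h * n)
    (hθ' : 1024 * ((m : ℝ) + 1) ^ 4 * θ ≤ J ^ 2 * h)
    (hsum : ∀ p q : ℕ, p ≤ q → q ≤ n → |∑ i ∈ Finset.Ioc p q, e i| ≤ K * √(n : ℝ))
    (hdrift : ∀ j, ∀ p q : ℕ, p ≤ changeTimes τ n j → changeTimes τ n j ≤ q →
      |∑ i ∈ Finset.Ioc p q, e i| ≤ J / 8 * ((q : ℝ) - p) + C)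
    (htr : ∑ i ∈ Finset.Ioc 0 n, max (e i ^ 2 - B) 0 ≤ θ * n)
    (hsq : ∑ i ∈ Finset.Ioc 0 n, e i ^ 2 ≤ M * n) (hz0 : |z 0| ≤ Z)
    (hρbar : |ρbar - ρ| ≤ L * (n : ℝ) ^ (-(1 / 2) : ℝ)) :
    (∀ j, |(s j : ℝ) - changeTimes τ n j|
      ≤ 4 * (4 * (m + 1) ^ 2 * (K * √(2 / h) + C + √E)) ^ 2 / J ^ 2) ∧
    ∀ k, (d k - δ k) ^ 2 * n ≤ 2 / h * (4 * (m + 1) ^ 2 * (K * √(2 / h) + C + √E)) ^ 2 := by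
  obtain ⟨ht0, ht1, htm, -⟩ := id hadm
  obtain ⟨⟨hs0, hs1, hsm, -⟩, hmin⟩ := hfit
  have hn : 0 < n := by
    rcases Nat.eq_zero_or_pos n with rfl | hn
    · norm_num at hn1
    · exact hn
  have hn' : (0 : ℝ) < n := by exact_mod_cast hn
  have ha : 0 < 1 - |ρ| := by linarith
  have hE0 : 0 ≤ E := by rw [hE]; positivity
  -- As `h * n ≥ 2`, rounding leaves `H ≥ h * n / 2`, and gaps of `4 * h * n`, less one for the
  -- floors, still exceed `3 * H`.
  set H : ℕ := ⌊h * n⌋₊ with hHdef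
  have hH1 : (H : ℝ) ≤ h * n := Nat.floor_le (by positivity)
  have hH2 : h * n < H + 1 := Nat.lt_floor_add_one _
  have hH3 : h * n / 2 ≤ H := by linarith
  have hHpos : 0 < H := by
    have : (0 : ℝ) < H := by linarith
    exact_mod_cast this
  have hgapH : ∀ k : Fin (m + 1),
      changeTimes τ n k.castSucc + 3 * H ≤ changeTimes τ n k.succ := by
    intro k
    have h1 : ((changeTimes τ n k.castSucc : ℕ) : ℝ) ≤ n * τ k.castSucc :=
      Nat.floor_le (mul_nonneg hn'.le (hτ0 _))
    have h2 : n * τ k.succ < (changeTimes τ n k.succ : ℕ) + 1 := Nat.lt_floor_add_one _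
    have h3 := mul_le_mul_of_nonneg_left (hgap k) hn'.le
    have h4 : ((changeTimes τ n k.castSucc + 3 * H : ℕ) : ℝ) ≤ (changeTimes τ n k.succ : ℕ) := by
      push_cast
      linarith
    exact_mod_cast h4
  have hw : ∀ l : Fin (m + 1), ∀ i ∈ Finset.Ioc (changeTimes τ n l.castSucc)
      (changeTimes τ n l.succ),
      decorrelate ρbar z i = δ l + (e i + (ρ - ρbar) * z (i - 1)) := by
    intro l i hi
    rw [decorrelate, hz l i hi]
    ring
  have hr := sum_sq_perturbation_le hn hρ ht0 ht1 hz hsq hz0 hρbar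
  rw [← hE, ← Real.sq_sqrt hE0] at hr
  -- The constants `1024` and `512` make the `θ` and `E` contributions at most `J ^ 2 * h * n / 4`
  -- each, the second strictly.
  have hVR : 4 * (4 * ((m : ℝ) + 1) ^ 2 * (√(2 * θ * n) + √E)) ^ 2 < J ^ 2 * H := by
    have h1 : (√(2 * θ * n) + √E) ^ 2 ≤ 2 * (2 * θ * n) + 2 * E := by
      have h2 := Real.sq_sqrt (show 0 ≤ 2 * θ * n by positivity)
      have h3 := Real.sq_sqrt hE0
      nlinarith [sq_nonneg (√(2 * θ * n) - √E)]
    have h4 := mul_le_mul_of_nonneg_left h1 (show 0 ≤ 64 * ((m : ℝ) + 1) ^ 4 by positivity)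
    have h5 := mul_le_mul_of_nonneg_right hθ' hn'.le
    have h6 := mul_le_mul_of_nonneg_left hH3 (sq_nonneg J)
    have h7 : 4 * (4 * ((m : ℝ) + 1) ^ 2 * (√(2 * θ * n) + √E)) ^ 2
      = 64 * ((m : ℝ) + 1) ^ 4 * (√(2 * θ * n) + √E) ^ 2 := by ring
    rw [h7]
    linarith
  have hsumH : ∀ p q : ℕ, p ≤ q → q ≤ n →
      |∑ i ∈ Finset.Ioc p q, e i| ≤ K * √(2 / h) * √(H : ℝ) := by
    intro p q hpq hqn
    refine (hsum p q hpq hqn).trans ?_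
    rw [mul_assoc, ← Real.sqrt_mul (by positivity)]
    gcongr
    rw [div_mul_eq_mul_div, le_div_iff₀ hh]
    linarith
  obtain ⟨hA, hBd⟩ := fit_error_le (V := √(2 * θ * n)) hsm htm.monotone hs0 ht0 hs1 ht1 hHpos hgapH
    hJ hjump hw (hmin δ _ hadm) (Real.sqrt_nonneg _) (Real.sqrt_nonneg _)
    (by positivity) hC hr
    (fun p q hpq hqn => abs_sum_Ioc_le_sqrt hB hθ hpq hqn htr (hsum p q hpq hqn) hn2)
    hVR hsumH (fun j p q hp hq _ => hdrift j p q hp hq)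
  refine ⟨hA, fun k => ?_⟩
  have h1 := mul_le_mul_of_nonneg_left hH3 (sq_nonneg (d k - δ k))
  have h2 := h1.trans (hBd k)
  rw [div_mul_eq_mul_div, le_div_iff₀ hh]
  linarith

/-! ### Probability of the good event -/

section Probability

variable {Ω : Type*} [MeasurableSpace Ω] {P : Measure Ω}

lemma measure_union_five_le {ι : Type*} [Fintype ι] {η : ℝ} (hη : 0 ≤ η) {A : ι → Set Ω}
    {A₁ A₂ A₃ A₄ A₅ : Set Ω} (hA : ∀ i, P (A i) ≤ ENNReal.ofReal η)
    (h₁ : P A₁ ≤ ENNReal.ofReal η) (h₂ : P A₂ ≤ ENNReal.ofReal η) (h₃ : P A₃ ≤ ENNReal.ofReal η)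
    (h₄ : P A₄ ≤ ENNReal.ofReal η) (h₅ : P A₅ ≤ ENNReal.ofReal η) :
    P ((⋃ i, A i) ∪ A₁ ∪ A₂ ∪ A₃ ∪ A₄ ∪ A₅) ≤ ENNReal.ofReal ((Fintype.card ι + 5) * η) := by
  have h₀ : P (⋃ i, A i) ≤ ENNReal.ofReal (Fintype.card ι * η) := by
    refine (measure_iUnion_fintype_le P A).trans ((Finset.sum_le_sum fun i _ => hA i).trans ?_)
    rw [Finset.sum_const, Finset.card_univ, nsmul_eq_mul, ENNReal.ofReal_mul (Nat.cast_nonneg _),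
      ENNReal.ofReal_natCast]
  have hU : ∀ {S T : Set Ω} {a : ℝ}, 0 ≤ a → P S ≤ ENNReal.ofReal a → P T ≤ ENNReal.ofReal η →
      P (S ∪ T) ≤ ENNReal.ofReal (a + η) := fun ha hS hT => by
    rw [ENNReal.ofReal_add ha hη]
    exact (measure_union_le _ _).trans (add_le_add hS hT)
  have := hU (by positivity) (hU (by positivity) (hU (by positivity) (hU (by positivity)
    (hU (by positivity) h₀ h₁) h₂) h₃) h₄) h₅
  convert this using 2
  ring

/-- With probability close to one, the change points of a least-squares fit are within a bounded
distance of the true ones, and the levels are within `O(n^{-1/2})` of the true ones. -/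
theorem exists_eventually_measure_fit_error_le [IsProbabilityMeasure P]
    {m : ℕ} {ρ : ℝ} (hρ : |ρ| < 1) {τ : Fin (m + 2) → ℝ} (hτ : StrictMono τ) (hτ_zero : τ 0 = 0)
    {δ : EuclideanSpace ℝ (Fin (m + 1))} (hδ : ∀ k : Fin m, δ k.succ ≠ δ k.castSucc)
    {ε : ℕ → Ω → ℝ} (hε_indep : iIndepFun (fun i : ℕ => ε (i + 1)) P)
    (hε_ident : ∀ i : ℕ, 1 ≤ i → IdentDistrib (ε i) (ε 1) P P)
    (hε_L2 : MemLp (ε 1) 2 P) (hε_mean : ∫ ω, ε 1 ω ∂P = 0)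
    {zInit : Ω → ℝ} (hzInit : Measurable zInit)
    {z : ℕ → ℕ → Ω → ℝ} (hz_zero : ∀ n ω, z n 0 ω = zInit ω)
    (hz : ∀ n ω, IsSegmentedAR1 ρ δ (changeTimes τ n) (fun i => ε i ω) (fun i => z n i ω))
    {ρbar : ℕ → Ω → ℝ}
    (hρbar : IsBigOP P (fun n ω => ρbar n ω - ρ) (fun n => (n : ℝ) ^ (-(1 / 2) : ℝ)))
    {Δ : ℕ → ℝ} (hΔ : ∀ᶠ n in atTop, changeTimes τ n ∈ admissible m (Δ n) n)
    {δhat : ℕ → Ω → EuclideanSpace ℝ (Fin (m + 1))} {that : ℕ → Ω → Fin (m + 2) → ℕ}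
    (hfit : ∀ᶠ n in atTop, ∀ ω, IsLeastSquaresFit (admissible m (Δ n) n)
      (decorrelate (ρbar n ω) (fun i => z n i ω)) (δhat n ω) (that n ω))
    {η : ℝ} (hη : 0 < η) :
    ∃ Q₁ Q₂ : ℝ, 0 ≤ Q₁ ∧ 0 ≤ Q₂ ∧ ∀ᶠ n in atTop,
      P {ω | ¬ ((∀ j, |(that n ω j : ℝ) - changeTimes τ n j| ≤ Q₁) ∧
        ∀ k, (δhat n ω k - δ k) ^ 2 * n ≤ Q₂)} ≤ ENNReal.ofReal η := by
  -- One share for the drift at each of the `m + 2` change times, and five for partial sums,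
  -- truncated energy, energy, initial value and `ρbar`.
  set η' : ℝ := η / (((m + 2 : ℕ) : ℝ) + 5) with hη'def
  have hη' : 0 < η' := by positivity
  set v : ℝ := ∫ ω, ε 1 ω ^ 2 ∂P with hv
  have hv0 : 0 ≤ v := integral_nonneg fun ω => sq_nonneg _
  have hint : Integrable (fun ω => ε 1 ω ^ 2) P := hε_L2.integrable_sq
  have H : ∀ a N : ℕ, ∀ x : ℝ, 0 < x →
      P {ω | ∃ j ≤ N, x < |∑ i ∈ Finset.Ioc a (a + j), ε i ω|}
        ≤ ENNReal.ofReal (N * v / x ^ 2) := fun a N x hx =>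
    measure_exists_abs_sum_Ioc_gt_le hε_indep hε_ident hε_L2 hε_mean a N hx
  obtain ⟨J, hJ, hjump⟩ := exists_pos_forall_le (f := fun k : Fin m => |δ k.succ - δ k.castSucc|)
    (fun k => abs_pos.mpr (sub_ne_zero.mpr (hδ k)))
  obtain ⟨g, hg, hgap⟩ := exists_pos_forall_le
    (f := fun k : Fin (m + 1) => τ k.succ - τ k.castSucc)
    (fun k => sub_pos.mpr (hτ (Fin.castSucc_lt_succ (i := k))))
  have hτ0 : ∀ k, 0 ≤ τ k := fun k => hτ_zero ▸ hτ.monotone (Fin.zero_le k)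
  set h : ℝ := g / 4 with hh
  have hh0 : 0 < h := by positivity
  obtain ⟨C, hC, hdrift⟩ := exists_measure_drift_le hv0 H (c := J / 8) (by positivity) hη'
  set θ : ℝ := J ^ 2 * h / (1024 * ((m : ℝ) + 1) ^ 4) with hθdef
  have hθ : 0 < θ := by positivity
  obtain ⟨B, hB, htr⟩ := exists_integral_max_sub_le hint (θ := η' * θ) (by positivity)
  obtain ⟨Z, -, hZ⟩ := exists_measure_abs_gt_le (P := P) hzInit hη'
  obtain ⟨L, hL⟩ := hρbar η' hη'
  -- The window inequality costs `8 * v / K ^ 2`; adding `1` ensures `K ≤ K ^ 2`, and positivity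
  -- even if `v = 0`.
  set K : ℝ := 8 * v / η' + 1 with hKdef
  have hK1 : 1 ≤ K := by rw [hKdef]; linarith [show 0 ≤ 8 * v / η' by positivity]
  have hK : 0 ≤ K := by linarith
  set M : ℝ := v / η' + 1 with hMdef
  have hM : 0 < M := by positivity
  set E : ℝ := L ^ 2 * ((Z ^ 2 + (2 * ‖δ‖ ^ 2 + 2 * M) / (1 - |ρ|)) / (1 - |ρ|)) with hE
  refine ⟨4 * (4 * (m + 1) ^ 2 * (K * √(2 / h) + C + √E)) ^ 2 / J ^ 2,
    2 / h * (4 * (m + 1) ^ 2 * (K * √(2 / h) + C + √E)) ^ 2, by positivity, by positivity, ?_⟩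
  have hlarge : ∀ {a : ℝ}, 0 < a → ∀ b : ℝ, ∀ᶠ n : ℕ in atTop, b < a * n := fun ha b =>
    (tendsto_natCast_atTop_atTop.const_mul_atTop ha).eventually_gt_atTop b
  filter_upwards [hL, hΔ, hfit, hlarge hh0 2, hlarge (show 0 < 2 * θ ^ 2 by positivity) (K ^ 2 * B),
    hlarge (show 0 < J ^ 2 * h by positivity) (512 * ((m : ℝ) + 1) ^ 4 * E)]
    with n hLn hadm hfitn hn1 hn2 hn3
  have hn0 : (0 : ℝ) < n := by
    by_contra hcon
    have := mul_nonpos_of_nonneg_of_nonpos hh0.le (not_lt.mp hcon)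
    linarith
  have h₁ : P {ω | ∃ p q : ℕ, 0 ≤ p + n ∧ p ≤ q ∧ q ≤ 0 + n ∧
      K * √(n : ℝ) < |∑ i ∈ Finset.Ioc p q, ε i ω|} ≤ ENNReal.ofReal η' := by
    refine (measure_exists_abs_sum_window_gt_le H 0 n (by positivity)).trans
      (ENNReal.ofReal_le_ofReal ?_)
    rw [mul_pow, Real.sq_sqrt hn0.le, div_le_iff₀ (by positivity)]
    have h1 : 8 * v ≤ η' * K := by
      rw [hKdef, mul_add, mul_div_cancel₀ _ hη'.ne']
      linarith
    have h2 : η' * K ≤ η' * K ^ 2 := by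
      gcongr
      nlinarith
    have h3 := mul_le_mul_of_nonneg_right (h1.trans h2) hn0.le
    linarith
  have h₂ : P {ω | θ * n < ∑ i ∈ Finset.Ioc 0 n, max (ε i ω ^ 2 - B) 0} ≤ ENNReal.ofReal η' := by
    refine (measure_sum_comp_gt_le hε_ident (φ := fun x => max (x ^ 2 - B) 0) (by fun_prop)
      (fun x => le_max_right _ _) (integrable_max_sub_zero hint B) hθ n).trans
      (ENNReal.ofReal_le_ofReal ?_)
    rwa [div_le_iff₀ hθ]
  have h₃ : P {ω | M * n < ∑ i ∈ Finset.Ioc 0 n, ε i ω ^ 2} ≤ ENNReal.ofReal η' := by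
    refine (measure_sum_comp_gt_le hε_ident (φ := fun x => x ^ 2) (by fun_prop)
      (fun x => sq_nonneg _) hint hM n).trans (ENNReal.ofReal_le_ofReal ?_)
    rw [div_le_iff₀ hM, hMdef, mul_add, mul_div_cancel₀ _ hη'.ne']
    linarith
  have hunion := measure_union_five_le hη'.le (fun j => hdrift (changeTimes τ n j)) h₁ h₂ h₃ hZ hLn
  rw [Fintype.card_fin, hη'def, mul_div_cancel₀ _ (by positivity)] at hunion
  -- Only an inclusion of events is used, so the estimators need not be measurable.
  refine (measure_mono fun ω hω => ?_).trans hunion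
  by_contra hcon
  simp only [Set.mem_union, Set.mem_iUnion, Set.mem_ofPred_eq, not_or, not_exists, not_and,
    not_lt] at hcon
  obtain ⟨⟨⟨⟨⟨hc0, hc1⟩, hc2⟩, hc3⟩, hc4⟩, hc5⟩ := hcon
  refine hω (fit_error_le_of_controlled hρ hτ0 hh0 hJ (fun k => ?_) hjump (hz n ω) hadm (hfitn ω)
    hK hC hB hθ hM.le hE hn1.le hn2.le hn3 ?_ (fun p q hpq hqn => ?_) hc0 hc2 hc3 ?_ hc5)
  · have := hgap k
    rw [hh]
    linarith
  · rw [hθdef, mul_div_cancel₀ _ (by positivity)]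
  · exact hc1 p q (Nat.zero_le _) hpq (by omega)
  · rw [hz_zero]; exact hc4

lemma tendstoInMeasure_of_isBigOP {E : Type*} [SeminormedAddCommGroup E] {X : ℕ → Ω → E} {x : E}
    {a : ℕ → ℝ} (ha : Tendsto a atTop (𝓝 0)) (h : IsBigOP P (fun n ω => ‖X n ω - x‖) a) :
    TendstoInMeasure P X atTop (fun _ => x) := by
  rw [tendstoInMeasure_iff_norm]
  intro c hc
  rw [ENNReal.tendsto_nhds_zero]
  intro η hη
  obtain ⟨η', hη'0, hη'⟩ : ∃ η' : ℝ, 0 < η' ∧ ENNReal.ofReal η' ≤ η := by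
    rcases eq_or_ne η ⊤ with rfl | htop
    · exact ⟨1, one_pos, le_top⟩
    · exact ⟨η.toReal, ENNReal.toReal_pos hη.ne' htop, ENNReal.ofReal_toReal_le⟩
  obtain ⟨M, hM⟩ := h η' hη'0
  have hMa : Tendsto (fun n => M * a n) atTop (𝓝 0) := by simpa using ha.const_mul M
  filter_upwards [hM, hMa.eventually_lt_const hc] with n hn hlt
  refine (measure_mono fun ω hω => ?_).trans (hn.trans hη')
  have hω' : c ≤ ‖X n ω - x‖ := hω
  show M * a n < |‖X n ω - x‖|
  rw [abs_of_nonneg (norm_nonneg _)]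
  exact hlt.trans_le hω'

end Probability

end AR1Seg

/-! ### Consistency and rates -/

/-- The norm on `Fin (m + 2) → ℝ` is the sup norm, the one on `EuclideanSpace` the Euclidean norm;
`TendstoInMeasure` is convergence in probability, here in the sup norm. -/
theorem mainTheorem1 {Ω : Type*} [MeasurableSpace Ω] (P : Measure Ω) [IsProbabilityMeasure P]
    -- the parameters of the model
    (m : ℕ) (ρ : ℝ) (hρ : |ρ| < 1)
    (τ : Fin (m + 2) → ℝ) (hτ : StrictMono τ) (hτ_zero : τ 0 = 0)
    (hτ_one : τ (Fin.last (m + 1)) = 1)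
    (δ : EuclideanSpace ℝ (Fin (m + 1)))
    (hδ : ∀ k : Fin m, δ k.succ ≠ δ k.castSucc)
    -- the i.i.d. centred innovations with finite variance, indexed by `i ≥ 1`
    (ε : ℕ → Ω → ℝ) (hε_indep : iIndepFun (fun i : ℕ => ε (i + 1)) P)
    (hε_ident : ∀ i : ℕ, 1 ≤ i → IdentDistrib (ε i) (ε 1) P P)
    (hε_L2 : MemLp (ε 1) 2 P) (hε_mean : ∫ ω, ε 1 ω ∂P = 0)
    -- the observed series `z n 0, …, z n n` for each sample size `n`
    (zInit : Ω → ℝ) (hzInit : Measurable zInit)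
    (z : ℕ → ℕ → Ω → ℝ) (hz_zero : ∀ n ω, z n 0 ω = zInit ω)
    (hz : ∀ n ω, AR1Seg.IsSegmentedAR1 ρ δ (AR1Seg.changeTimes τ n)
      (fun i => ε i ω) (fun i => z n i ω))
    -- the plugged-in estimator of the autoregression parameter
    (ρbar : ℕ → Ω → ℝ) (hρbar_meas : ∀ n, Measurable (ρbar n))
    (hρbar : AR1Seg.IsBigOP P (fun n ω => ρbar n ω - ρ) (fun n => (n : ℝ) ^ (-(1 / 2) : ℝ)))
    -- the minimal segment length allows the true segmentation
    (Δ : ℕ → ℝ)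
    (hΔ : ∀ᶠ n in atTop, AR1Seg.changeTimes τ n ∈ AR1Seg.admissible m (Δ n) n)
    -- the least-squares segmentation of the decorrelated series
    (δhat : ℕ → Ω → EuclideanSpace ℝ (Fin (m + 1))) (that : ℕ → Ω → Fin (m + 2) → ℕ)
    (hfit : ∀ᶠ n in atTop, ∀ ω, AR1Seg.IsLeastSquaresFit (AR1Seg.admissible m (Δ n) n)
      (AR1Seg.decorrelate (ρbar n ω) (fun i => z n i ω)) (δhat n ω) (that n ω)) :
    TendstoInMeasure P (fun n ω => AR1Seg.fractions n (that n ω)) atTop (fun _ => τ) ∧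
    AR1Seg.IsBigOP P (fun n ω => ‖AR1Seg.fractions n (that n ω) - τ‖) (fun n => (n : ℝ)⁻¹) ∧
    AR1Seg.IsBigOP P (fun n ω => ‖δhat n ω - δ‖) (fun n => (n : ℝ) ^ (-(1 / 2) : ℝ)) := by

  have key := fun {η : ℝ} (hη : 0 < η) =>
    AR1Seg.exists_eventually_measure_fit_error_le hρ hτ hτ_zero hδ hε_indep hε_ident hε_L2 hε_mean hzInit hz_zero hz hρbar hΔ hfit hη
  have hτ0 : ∀ k, 0 ≤ τ k := fun k => hτ_zero ▸ hτ.monotone (Fin.zero_le k)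
  have hfrac : AR1Seg.IsBigOP P (fun n ω => ‖AR1Seg.fractions n (that n ω) - τ‖)
      (fun n => (n : ℝ)⁻¹) := by
    intro η hη
    obtain ⟨Q₁, Q₂, hQ₁, -, hQ⟩ := key hη
    -- The extra `1` pays for rounding `n * τ k` down to `changeTimes τ n k`.
    refine ⟨Q₁ + 1, ?_⟩
    filter_upwards [hQ, eventually_gt_atTop 0] with n hn hpos
    have hn' : (0 : ℝ) < n := by exact_mod_cast hpos
    refine (measure_mono fun ω hω => ?_).trans hn
    rintro ⟨hgood, -⟩
    rw [Set.mem_ofPred_eq] at hω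
    refine hω.not_ge ?_
    rw [abs_of_nonneg (norm_nonneg _), pi_norm_le_iff_of_nonneg (by positivity)]
    intro k
    have h1 := hgood k
    have h2 := AR1Seg.abs_changeTimes_sub_le hpos (hτ0 k)
    have h3 := abs_sub_le (that n ω k : ℝ) (AR1Seg.changeTimes τ n k) (n * τ k)
    have h4 : AR1Seg.fractions n (that n ω) k - τ k = ((that n ω k : ℝ) - n * τ k) * (n : ℝ)⁻¹ := by
      rw [AR1Seg.fractions]
      field_simp
    rw [Pi.sub_apply, h4, norm_mul, Real.norm_eq_abs, Real.norm_of_nonneg (inv_nonneg.mpr hn'.le)]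
    gcongr
    linarith
  refine ⟨AR1Seg.tendstoInMeasure_of_isBigOP tendsto_inv_atTop_nhds_zero_nat hfrac, hfrac, ?_⟩
  intro η hη
  obtain ⟨Q₁, Q₂, -, hQ₂, hQ⟩ := key hη
  -- Each of the `m + 1` squared coordinates is at most `Q₂ / n`.
  refine ⟨√((m + 1) * Q₂), ?_⟩
  filter_upwards [hQ, eventually_gt_atTop 0] with n hn hpos
  have hn' : (0 : ℝ) < n := by exact_mod_cast hpos
  refine (measure_mono fun ω hω => ?_).trans hn
  rintro ⟨-, hgood⟩
  rw [Set.mem_ofPred_eq] at hω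
  refine hω.not_ge ?_
  rw [abs_of_nonneg (norm_nonneg _), EuclideanSpace.norm_eq, Real.rpow_neg hn'.le,
    ← Real.sqrt_eq_rpow, ← Real.sqrt_inv, ← Real.sqrt_mul (by positivity)]
  refine Real.sqrt_le_sqrt ?_
  have hk : ∀ k, ‖(δhat n ω - δ) k‖ ^ 2 ≤ Q₂ * (n : ℝ)⁻¹ := by
    intro k
    rw [Real.norm_eq_abs, sq_abs, ← div_eq_mul_inv, le_div_iff₀ hn']
    exact hgood k
  refine (Finset.sum_le_sum fun k _ => hk k).trans_eq ?_
  rw [Finset.sum_const, Finset.card_univ, Fintype.card_fin, nsmul_eq_mul]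
  push_cast
  ring
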